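/- All Hilbert spaces are finite-dimensional and complex, $\log$ is the logarithm to base $2$, $M\cdot X=MXM^\dagger$, $\|M\|_1=\operatorname{tr}\sqrt{M^\dagger M}$, a superscript denotes the systems on which an operator acts (omitted systems are traced out, omitted identities are implicit), and a pure state $\psi$ is $|\psi\rangle\langle\psi|$ with $|\psi\rangle$ a unit vector. A partial isometry is an operator all of whose singular values are $0$ or $1$. Entropies. For $\rho^{AB}\geq 0$ let $$H_{\min}(A|B)_\rho=-\log\min\{\operatorname{tr}\sigma^B:\ \sigma^B\geq 0,\ \rho^{AB}\leq \mathbb I^A\otimes\sigma^B\},$$ $$H_2(A|B)_\rho=-\log\inf_{\sigma^B>0,\ \operatorname{tr}\sigma^B=1}\operatorname{tr}\Big[\big((\mathbb I^A\otimes\sigma^B)^{-1/2}\rho^{AB}\big)^2\Big],$$ and $H_{\max}(A|B)_\rho=-H_{\min}(A|C)_\rho$ for any purification $\rho^{ABC}$ of $\rho^{AB}$ (with $-\log 0=+\infty$); unconditional entropies are those with trivial $B$. With $F(\rho,\tau)=\|\sqrt\rho\sqrt\tau\|_1$, $d_F(\rho,\tau)=\sqrt{1-F(\rho,\tau)^2}$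 and $\mathfrak B(\rho,\varepsilon)=\{\tau\geq 0:\ \operatorname{tr}\tau\leq 1,\ d_F(\rho,\tau)\leq\varepsilon\}$, let $H_2^\varepsilon(A|B)_\rho=\sup_{\tau\in\mathfrak B(\rho,\varepsilon)}H_2(A|B)_\tau$ and $H_{\max}^\varepsilon(A|B)_\rho=\inf_{\tau\in\mathfrak B(\rho,\varepsilon)}H_{\max}(A|B)_\tau$. Theorem. Let $\psi^{ABR}$ be a pure state, let $\mathcal N^{A'\to C}$ be a completely positive trace-preserving map with Stinespring dilation $U_{\mathcal N}^{A'\to CE}$ (a partial isometry with $\mathcal N(X)=\operatorname{tr}_E[U_{\mathcal N}\cdot X]$) and complementary channel $\bar{\mathcal N}^{A'\to E}(X)=\operatorname{tr}_C[U_{\mathcal N}\cdot X]$, let $\mathsf A''\cong\mathsf A'$, let $\sigma^{A''A'}$ be any pure state, put $\omega^{A''CE}=U_{\mathcal N}\cdot\sigma^{A''A'}$, and let $\varepsilon>0$. Then there exist an encoding partial isometry $V^{A\to A'}$ and a decoding completely positive trace-preserving map $\mathcal D^{CB\to AB}$ such that $$\big\|\bar{\mathcal N}(V\cdot\psi^{AR})-\omega^E\otimes\psi^R\big\|_1\leq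 2\sqrt{\delta_1}+\delta_2$$ and $$\big\|(\mathcal D\circ\mathcal N)(V\cdot\psi^{ABR})-\psi^{ABR}\big\|_1\leq 2\sqrt{2\sqrt{\delta_1}+\delta_2},$$ where $$\delta_1=3\times 2^{\frac12H_{\max}^\varepsilon(A)_\psi-\frac12H_2^\varepsilon(A'')_\omega}+24\varepsilon,\qquad \delta_2=3\times 2^{-\frac12H_2^\varepsilon(A''|E)_\omega-\frac12H_2^\varepsilon(A|R)_\psi}+24\varepsilon.$$ -/

import Mathlib

open scoped Matrix Kronecker MatrixOrder ComplexOrder ENNReal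

noncomputable section

namespace QDecoupling

/-! Finite-dimensional quantum systems are represented by finite index types: the Hilbert space of
the system `a` is `ℂ ^ a`, operators from `a` to `b` are `Matrix b a ℂ`, and a composite system is
the product of the index types. -/

section Basic

variable {a b c : Type*}

/-- A normalized vector `|ψ⟩`. -/
def IsKet [Fintype a] (ψ : a → ℂ) : Prop := star ψ ⬝ᵥ ψ = 1

/-- The operator `|ψ⟩⟨ψ|`. -/
def ketbra (ψ : a → ℂ) : Matrix a a ℂ := Matrix.vecMulVec ψ (star ψ)

/-- Conjugation `M · X = M X M†`. -/
def conj [Fintype a] (M : Matrix b a ℂ) (X : Matrix a a ℂ) : Matrix b b ℂ := M * X * Mᴴ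

/-- A partial isometry: `V† V` and `V V†` are (orthogonal) projectors, i.e. idempotent, since
they are Hermitian anyway. -/
def IsPartialIsometry [Fintype a] [Fintype b] (V : Matrix b a ℂ) : Prop :=
  IsIdempotentElem (Vᴴ * V) ∧ IsIdempotentElem (V * Vᴴ)

/-- Partial trace over the first factor. -/
def traceFst [Fintype a] (X : Matrix (a × b) (a × b) ℂ) : Matrix b b ℂ :=
  fun i j => ∑ k, X (k, i) (k, j)

/-- Partial trace over the second factor. -/
def traceSnd [Fintype b] (X : Matrix (a × b) (a × b) ℂ) : Matrix a a ℂ :=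
  fun i j => ∑ k, X (i, k) (j, k)

/-- Partial trace over the middle one of three factors. -/
def traceMid [Fintype b] (X : Matrix (a × b × c) (a × b × c) ℂ) : Matrix (a × c) (a × c) ℂ :=
  fun i j => ∑ k, X (i.1, k, i.2) (j.1, k, j.2)

/-- The same operator on `a(bc)`, seen as an operator on `(ab)c`. -/
def assoc (X : Matrix (a × b × c) (a × b × c) ℂ) : Matrix ((a × b) × c) ((a × b) × c) ℂ :=
  X.submatrix (Equiv.prodAssoc a b c) (Equiv.prodAssoc a b c)

/-- `(T ⊗ id)(X)`: the linear map `T` applied to the first factor of a bipartite operator. -/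
def applyFst (T : Matrix a a ℂ →ₗ[ℂ] Matrix b b ℂ) (X : Matrix (a × c) (a × c) ℂ) :
    Matrix (b × c) (b × c) ℂ :=
  fun i j => T (fun k l => X (k, i.2) (l, j.2)) i.1 j.1

/-- Completely positive trace-preserving superoperators. -/
structure IsCPTP [Fintype a] [Fintype b] (T : Matrix a a ℂ →ₗ[ℂ] Matrix b b ℂ) : Prop where
  completely_positive : ∀ (n : ℕ) (X : Matrix (a × Fin n) (a × Fin n) ℂ),
    X.PosSemidef → (applyFst T X).PosSemidef
  trace_preserving : ∀ X : Matrix a a ℂ, (T X).trace = X.trace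

/-- `U : a → bc` is a Stinespring dilation of `T : a → b`, with environment `c`. -/
structure IsStinespringDilation [Fintype a] [Fintype b] [Fintype c]
    (T : Matrix a a ℂ →ₗ[ℂ] Matrix b b ℂ) (U : Matrix (b × c) a ℂ) : Prop where
  partial_isometry : IsPartialIsometry U
  dilates : ∀ X : Matrix a a ℂ, T X = traceSnd (conj U X)

/-- The complementary channel of a dilation `U : a → bc`: the channel to the environment `c`. -/
def complementary [Fintype a] [Fintype b] (U : Matrix (b × c) a ℂ) :
    Matrix a a ℂ →ₗ[ℂ] Matrix c c ℂ where
  toFun X := traceFst (conj U X)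
  map_add' X Y := by
    ext i j
    simp [traceFst, conj, Matrix.mul_add, Matrix.add_mul, Finset.sum_add_distrib]
  map_smul' r X := by
    ext i j
    simp [traceFst, conj, Finset.mul_sum]

/-- The trace norm `‖M‖₁ = tr √(M† M)`. -/
def traceNorm [Fintype a] [DecidableEq a] (M : Matrix a a ℂ) : ℝ :=
  (CFC.sqrt (Mᴴ * M)).trace.re

/-- The fidelity `F(ρ, σ) = ‖√ρ √σ‖₁`. -/
def fidelity [Fintype a] [DecidableEq a] (ρ σ : Matrix a a ℂ) : ℝ :=
  traceNorm (CFC.sqrt ρ * CFC.sqrt σ)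

/-- The fidelity distance `d_F(ρ, σ) = √(1 - F(ρ, σ)²)`. -/
def fidelityDist [Fintype a] [DecidableEq a] (ρ σ : Matrix a a ℂ) : ℝ :=
  √(1 - fidelity ρ σ ^ 2)

/-- The `ε`-ball of subnormalized positive operators around `ρ` in fidelity distance. -/
def smoothBall [Fintype a] [DecidableEq a] (ρ : Matrix a a ℂ) (ε : ℝ) : Set (Matrix a a ℂ) :=
  {τ | τ.PosSemidef ∧ τ.trace.re ≤ 1 ∧ fidelityDist ρ τ ≤ ε}

end Basic

section Entropy

/-- The base-2 logarithm, with `log 0 = -∞` and `log ∞ = ∞`. -/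
def log2 (x : ℝ≥0∞) : EReal := ENNReal.log x / (Real.log 2 : ℝ)

/-- The power `2 ^ x`, with `2 ^ (-∞) = 0` and `2 ^ ∞ = ∞`. -/
def pow2 (x : EReal) : ℝ≥0∞ := EReal.exp (x * (Real.log 2 : ℝ))

variable {a b : Type*} [Fintype a] [DecidableEq a] [Fintype b] [DecidableEq b]

/-- The conditional min-entropy
`H_min(A|B)_ρ = - log min {tr σ : σ ∈ Pos(B), ρ ≤ 1 ⊗ σ}`. -/
def Hmin (ρ : Matrix (a × b) (a × b) ℂ) : EReal :=
  -log2 (⨅ (σ : Matrix b b ℂ) (_ : σ.PosSemidef ∧ ρ ≤ (1 : Matrix a a ℂ) ⊗ₖ σ),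
    ENNReal.ofReal σ.trace.re)

/-- The conditional 2-entropy `H_2(A|B)_ρ = - log inf_σ tr [((1 ⊗ σ)^{-1/2} ρ)²]`, where `σ` runs
over the positive definite density operators on `B`. -/
def H2 (ρ : Matrix (a × b) (a × b) ℂ) : EReal :=
  -log2 (⨅ (σ : Matrix b b ℂ) (_ : σ.PosDef ∧ σ.trace = 1),
    ENNReal.ofReal ((((CFC.sqrt ((1 : Matrix a a ℂ) ⊗ₖ σ))⁻¹ * ρ) ^ 2).trace.re))

/-- The canonical purification `∑ᵢⱼ (√ρ)ᵢⱼ |i⟩|j⟩` of the positive operator `ρ`, whose marginal on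
the first factor is `ρ`. -/
def purify (ρ : Matrix a a ℂ) : a × a → ℂ := fun p => CFC.sqrt ρ p.1 p.2

/-- The conditional max-entropy `H_max(A|B)_ρ = - H_min(A|C)`, evaluated on the canonical
purification of `ρ` with purifying system `C`. -/
def Hmax (ρ : Matrix (a × b) (a × b) ℂ) : EReal :=
  -Hmin (traceMid (assoc' (ketbra (purify ρ))))
where
  /-- An operator on `(ab)c`, seen as an operator on `a(bc)`. -/
  assoc' (X : Matrix ((a × b) × (a × b)) ((a × b) × (a × b)) ℂ) :
      Matrix (a × b × (a × b)) (a × b × (a × b)) ℂ :=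
    X.submatrix (Equiv.prodAssoc a b (a × b)).symm (Equiv.prodAssoc a b (a × b)).symm

/-- The `ε`-smooth conditional 2-entropy. -/
def H2smooth (ε : ℝ) (ρ : Matrix (a × b) (a × b) ℂ) : EReal :=
  ⨆ τ ∈ smoothBall ρ ε, H2 τ

/-- The `ε`-smooth conditional max-entropy. -/
def Hmaxsmooth (ε : ℝ) (ρ : Matrix (a × b) (a × b) ℂ) : EReal :=
  ⨅ τ ∈ smoothBall ρ ε, Hmax τ

/-- An operator on `A`, seen as an operator on `AB` with `B` the trivial system. Unconditional
entropies are entropies conditioned on the trivial system. -/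
def uncond (ρ : Matrix a a ℂ) : Matrix (a × Unit) (a × Unit) ℂ := ρ.submatrix Prod.fst Prod.fst

end Entropy

end QDecoupling

end

/-!
The encoder is found by a random choice, and the decoder by Uhlmann's theorem.

Let `g` be a matrix of independent random phases from `A` to `A''`, uniform among the third roots of
unity, and consider the operator `M = ∑ g_{ia} σ_{ia'} |a'⟩⟨a|` from `A` to `A'`. The state of `E`
and `R` after `M` and the channel is `∑ g_{ia} ḡ_{jb} ω_{ij} ⊗ ψ_{ab}` (`twist`), in terms of the
blocks of `ω^{A''E}` and `ψ^{AR}`. As a form in the phases it has the constant diagonal part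
`ω^E ⊗ ψ^R`, while the off-diagonal terms are pairwise uncorrelated, because the products
`g_p ḡ_q` with `p ≠ q` are distinct nontrivial characters of a finite group. Its variance in the
Hilbert–Schmidt norm is therefore at most `‖ω‖₂² ‖ψ‖₂²`. Conjugating by fourth roots of the
states in the definition of the 2-entropies turns this into a bound on the mean trace distance by
`2^{-H₂(A''|E)/2 - H₂(A|R)/2}`. No invariant measure on the unitary group is needed, and there is no
constraint on the dimensions of `A` and `A''`.

The smoothing costs `8ε`: two operators at fidelity distance `ε` can be written as `A A†` and
`B B†` with `‖A - B‖₂ ‖A + B‖₂ ≤ 2ε` (`exists_factor_of_mem_smoothBall`), and the inequality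
`‖A A† - B B†‖₁ ≤ ‖A - B‖₂ ‖A + B‖₂` (`traceNorm_mul_conjTranspose_sub_le`) survives the
averaging. The result is `sum_traceNorm_twist_sub_le`.

This is applied twice to the same phases: to `E` and `R`, and to the trivial system and `BR`, where
it says that `M ψ` nearly has the marginal `ψ^{BR}`. In the second case the 2-entropy of `A` given
`BR` is estimated by the max-entropy of `A`: a partial isometry takes the purification of the
smoothed state of `A` into `BR`, and the 2-entropy is at least the min-entropy
(`exists_column_of_mem_smoothBall`, `exists_collision_lt`). By Uhlmann's theorem, in the form
obtained from the Powers–Størmer inequality (`exists_uhlmann`), some partial isometry `V` satisfies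
`V ψ ≈ M ψ`. Hence the environment is nearly decoupled from `R` after the encoding by `V`, and a
second use of Uhlmann's theorem provides the decoder (`exists_decoder`).

Some phases do within a factor `2` as well as the mean in both respects. The rest of the factors `3`
and `24` in `δ₁` and `δ₂` makes up for infima that are not attained and for `M ψ` not being
normalized.
-/

noncomputable section

namespace QDecoupling

/-! ### The Hilbert–Schmidt norm -/

section HilbertSchmidt

variable {l m n : Type*} [Fintype l] [Fintype m] [Fintype n]

/-- A rectangular matrix as a vector of the Euclidean space of its entries. -/
def hsVec (M : Matrix m n ℂ) : EuclideanSpace ℂ (m × n) := WithLp.toLp 2 fun p => M p.1 p.2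

/-- The Hilbert–Schmidt norm of a rectangular matrix. -/
def hsNorm (M : Matrix m n ℂ) : ℝ := ‖hsVec M‖

lemma hsNorm_nonneg (M : Matrix m n ℂ) : 0 ≤ hsNorm M := norm_nonneg _

lemma hsNorm_sq (M : Matrix m n ℂ) : hsNorm M ^ 2 = ∑ i, ∑ j, ‖M i j‖ ^ 2 := by
  rw [hsNorm, EuclideanSpace.norm_sq_eq, Fintype.sum_prod_type]
  rfl

lemma inner_hsVec (M N : Matrix m n ℂ) : inner ℂ (hsVec M) (hsVec N) = (Mᴴ * N).trace := by
  rw [PiLp.inner_apply, Fintype.sum_prod_type_right]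
  simp [hsVec, Matrix.trace, Matrix.mul_apply, mul_comm]

lemma hsNorm_sq_eq_trace (M : Matrix m n ℂ) : hsNorm M ^ 2 = (Mᴴ * M).trace.re := by
  rw [← inner_hsVec, hsNorm]
  exact norm_sq_eq_re_inner (𝕜 := ℂ) _

lemma hsNorm_sq_eq_trace' (M : Matrix m n ℂ) : hsNorm M ^ 2 = (M * Mᴴ).trace.re := by
  rw [hsNorm_sq_eq_trace, Matrix.trace_mul_comm]

lemma norm_trace_conjTranspose_mul_le (M N : Matrix m n ℂ) :
    ‖(Mᴴ * N).trace‖ ≤ hsNorm M * hsNorm N := by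
  rw [← inner_hsVec]
  exact norm_inner_le_norm _ _

lemma hsNorm_add_le (M N : Matrix m n ℂ) : hsNorm (M + N) ≤ hsNorm M + hsNorm N :=
  norm_add_le (hsVec M) (hsVec N)

lemma hsNorm_conjTranspose (M : Matrix m n ℂ) : hsNorm Mᴴ = hsNorm M := by
  rw [← sq_eq_sq₀ (hsNorm_nonneg _) (hsNorm_nonneg _), hsNorm_sq_eq_trace, hsNorm_sq_eq_trace',
    Matrix.conjTranspose_conjTranspose]

lemma norm_trace_mul_le (M : Matrix m n ℂ) (N : Matrix n m ℂ) :
    ‖(M * N).trace‖ ≤ hsNorm M * hsNorm N := by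
  have := norm_trace_conjTranspose_mul_le Mᴴ N
  rwa [Matrix.conjTranspose_conjTranspose, hsNorm_conjTranspose] at this

lemma hsNorm_add_sq (M N : Matrix m n ℂ) :
    hsNorm (M + N) ^ 2 = hsNorm M ^ 2 + 2 * (Mᴴ * N).trace.re + hsNorm N ^ 2 := by
  rw [← inner_hsVec]
  exact norm_add_sq (𝕜 := ℂ) (hsVec M) (hsVec N)

lemma hsNorm_sub_sq (M N : Matrix m n ℂ) :
    hsNorm (M - N) ^ 2 = hsNorm M ^ 2 - 2 * (Mᴴ * N).trace.re + hsNorm N ^ 2 := by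
  rw [← inner_hsVec]
  exact norm_sub_sq (𝕜 := ℂ) (hsVec M) (hsVec N)

end HilbertSchmidt

/-! ### Partial isometries and the polar decomposition -/

section Polar

variable {l m n : Type*} [Fintype l] [Fintype m] [Fintype n]

lemma IsPartialIsometry.conjTranspose {V : Matrix m n ℂ} (h : IsPartialIsometry V) :
    IsPartialIsometry Vᴴ := by
  simpa [IsPartialIsometry] using h.symm

lemma IsPartialIsometry.transpose {V : Matrix m n ℂ} (h : IsPartialIsometry V) :
    IsPartialIsometry Vᵀ := by
  have key : ∀ {k l : Type _} [Fintype k] [Fintype l] (W : Matrix k l ℂ),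
      IsIdempotentElem (W * Wᴴ) → IsIdempotentElem (Wᵀᴴ * Wᵀ) := by
    intro k l _ _ W hW
    have := congrArg Matrix.transpose hW.eq
    simp only [Matrix.transpose_mul] at this
    rw [IsIdempotentElem, Matrix.conjTranspose, Matrix.transpose_transpose]
    simpa [Matrix.conjTranspose, Matrix.transpose_map] using this
  have key' : ∀ {k l : Type _} [Fintype k] [Fintype l] (W : Matrix k l ℂ),
      IsIdempotentElem (Wᴴ * W) → IsIdempotentElem (Wᵀ * Wᵀᴴ) := by
    intro k l _ _ W hW
    have := congrArg Matrix.transpose hW.eq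
    simp only [Matrix.transpose_mul] at this
    rw [IsIdempotentElem]
    simpa [Matrix.conjTranspose, Matrix.transpose_map] using this
  exact ⟨key V h.2, key' V h.1⟩

lemma IsPartialIsometry.posSemidef_one_sub [DecidableEq n] {V : Matrix m n ℂ}
    (h : IsPartialIsometry V) : (1 - Vᴴ * V).PosSemidef := by
  have h1 : 1 - Vᴴ * V = (1 - Vᴴ * V)ᴴ * (1 - Vᴴ * V) := by
    have := h.1.eq
    simp only [Matrix.conjTranspose_sub, Matrix.conjTranspose_one, Matrix.conjTranspose_mul,
      Matrix.conjTranspose_conjTranspose, Matrix.sub_mul, Matrix.mul_sub, Matrix.one_mul,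
      Matrix.mul_one, this]
    abel
  rw [h1]
  exact Matrix.posSemidef_conjTranspose_mul_self _

lemma hsNorm_mul_le_of_isPartialIsometry {V : Matrix m n ℂ} (h : IsPartialIsometry V)
    (M : Matrix n l ℂ) : hsNorm (V * M) ≤ hsNorm M := by
  classical
  have h1 := (h.posSemidef_one_sub.conjTranspose_mul_mul_same M).trace_nonneg
  have h2 := (Complex.le_def.1 h1).1
  rw [← sq_le_sq₀ (hsNorm_nonneg _) (hsNorm_nonneg _), hsNorm_sq_eq_trace, hsNorm_sq_eq_trace]
  simp only [Matrix.mul_sub, Matrix.sub_mul, Matrix.mul_one, Matrix.trace_sub, Complex.zero_re,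
    Complex.sub_re, Matrix.conjTranspose_mul, Matrix.mul_assoc] at h2 ⊢
  linarith

lemma hsNorm_mul_le_of_isPartialIsometry_right {V : Matrix m n ℂ} (h : IsPartialIsometry V)
    (M : Matrix l m ℂ) : hsNorm (M * V) ≤ hsNorm M := by
  rw [← hsNorm_conjTranspose, Matrix.conjTranspose_mul, ← hsNorm_conjTranspose M]
  exact hsNorm_mul_le_of_isPartialIsometry h.conjTranspose _

variable [DecidableEq n]

lemma sqrt_isHermitian (X : Matrix n n ℂ) : (CFC.sqrt X)ᴴ = CFC.sqrt X :=
  (Matrix.nonneg_iff_posSemidef.1 (CFC.sqrt_nonneg X)).isHermitian.eq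

lemma sqrt_posSemidef (X : Matrix n n ℂ) : (CFC.sqrt X).PosSemidef :=
  Matrix.nonneg_iff_posSemidef.1 (CFC.sqrt_nonneg X)

lemma sqrt_mul_sqrt {X : Matrix n n ℂ} (hX : X.PosSemidef) : CFC.sqrt X * CFC.sqrt X = X :=
  CFC.sqrt_mul_sqrt_self X (Matrix.nonneg_iff_posSemidef.2 hX)

lemma sqrt_eq_of_mul_self {X Y : Matrix n n ℂ} (hY : Y.PosSemidef) (h : Y * Y = X) :
    CFC.sqrt X = Y :=
  CFC.sqrt_unique h (Matrix.nonneg_iff_posSemidef.2 hY)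

lemma continuousOn_spectrum (f : ℝ → ℝ) (X : Matrix n n ℂ) : ContinuousOn f (spectrum ℝ X) :=
  Matrix.finite_real_spectrum.continuousOn f

/-- Polar decomposition: with `|Y| = √(Y† Y)`, the pseudo-inverse of `|Y|` yields a partial
isometry `V = Y |Y|⁻¹` with `V† Y = |Y|` and `V |Y| = Y`. -/
lemma exists_polar (Y : Matrix m n ℂ) : ∃ V : Matrix m n ℂ, IsPartialIsometry V ∧
    Vᴴ * Y = CFC.sqrt (Yᴴ * Y) ∧ V * CFC.sqrt (Yᴴ * Y) = Y := by
  have hH : (Yᴴ * Y).PosSemidef := Matrix.posSemidef_conjTranspose_mul_self Y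
  set H := Yᴴ * Y with hHdef
  have hsa : IsSelfAdjoint H := hH.isHermitian
  have hnn : ∀ x ∈ spectrum ℝ H, 0 ≤ x := fun x hx =>
    spectrum_nonneg_of_nonneg (Matrix.nonneg_iff_posSemidef.2 hH) hx
  -- since `0⁻¹ = 0`, the function `x ↦ (√x)⁻¹` is the pseudo-inverse of the square root
  set G := cfc (fun x : ℝ => (√x)⁻¹) H with hG
  have hGsa : Gᴴ = G := (cfc_predicate (fun x : ℝ => (√x)⁻¹) H : IsSelfAdjoint G)
  have hsqrt : CFC.sqrt H = cfc Real.sqrt H := by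
    rw [CFC.sqrt_eq_real_sqrt H (Matrix.nonneg_iff_posSemidef.2 hH), cfcₙ_eq_cfc]
  have hGH : G * H = CFC.sqrt H := by
    rw [hsqrt]
    have hid : H = cfc (fun x : ℝ => x) H := (cfc_id' ℝ H).symm
    have : G * H = G * cfc (fun x : ℝ => x) H := by rw [← hid]
    rw [this, hG, ← cfc_mul _ _ H (continuousOn_spectrum _ _) (continuousOn_spectrum _ _)]
    refine cfc_congr fun x hx => ?_
    have h0 := hnn x hx
    by_cases h : x = 0
    · simp [h]
    · have : √x ≠ 0 := fun h' => h ((Real.sqrt_eq_zero h0).1 h')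
      field_simp
      simp [Real.sq_sqrt h0]
  have hGHG : IsIdempotentElem (G * H * G) := by
    have : G * H * G = cfc (fun x : ℝ => √x * (√x)⁻¹) H := by
      rw [hGH, hsqrt, hG, ← cfc_mul _ _ H (continuousOn_spectrum _ _) (continuousOn_spectrum _ _)]
    rw [IsIdempotentElem, this,
      ← cfc_mul _ _ H (continuousOn_spectrum _ _) (continuousOn_spectrum _ _)]
    refine cfc_congr fun x _ => ?_
    by_cases h : √x = 0
    · simp [h]
    · simp [h]
  have hVV : (Y * G)ᴴ * (Y * G) = G * H * G := by
    rw [Matrix.conjTranspose_mul, hGsa, hHdef]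
    simp only [Matrix.mul_assoc]
  have hzero : Y * G * CFC.sqrt H = Y := by
    rw [← sub_eq_zero, ← Matrix.conjTranspose_mul_self_eq_zero]
    have e1 : Yᴴ * (Y * G * CFC.sqrt H) = H := by
      have : H * G = CFC.sqrt H := by
        have := congrArg Matrix.conjTranspose hGH
        rwa [Matrix.conjTranspose_mul, hGsa, sqrt_isHermitian, hH.isHermitian.eq] at this
      rw [← Matrix.mul_assoc, ← Matrix.mul_assoc, ← hHdef, this, sqrt_mul_sqrt hH]
    have e2 : (Y * G * CFC.sqrt H)ᴴ * (Y * G * CFC.sqrt H) = H := by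
      rw [Matrix.conjTranspose_mul, Matrix.conjTranspose_mul, hGsa, sqrt_isHermitian,
        Matrix.mul_assoc, Matrix.mul_assoc, e1, hGH, sqrt_mul_sqrt hH]
    have e3 : (Y * G * CFC.sqrt H)ᴴ * Y = H := by
      have := congrArg Matrix.conjTranspose e1
      rwa [Matrix.conjTranspose_mul, Matrix.conjTranspose_conjTranspose, hH.isHermitian.eq] at this
    rw [Matrix.conjTranspose_sub, Matrix.sub_mul, Matrix.mul_sub, Matrix.mul_sub, e1, e2, e3,
      ← hHdef]
    abel
  refine ⟨Y * G, ⟨by rwa [hVV], ?_⟩, ?_, hzero⟩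
  · have : Y * G * (G * H * G) = Y * G := by
      rw [hGH, ← Matrix.mul_assoc, hzero]
    rw [IsIdempotentElem, Matrix.mul_assoc (Y * G), ← Matrix.mul_assoc _ _ (Y * G)ᴴ, hVV,
      ← Matrix.mul_assoc, this]
  · rw [Matrix.conjTranspose_mul, hGsa, Matrix.mul_assoc, ← hHdef, hGH]

end Polar

/-! ### The trace norm -/

section TraceNorm

variable {l m n : Type*} [Fintype l] [Fintype m] [Fintype n]

lemma trace_sqrt_re_nonneg [DecidableEq n] (X : Matrix n n ℂ) : 0 ≤ (CFC.sqrt X).trace.re :=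
  (Complex.le_def.1 (sqrt_posSemidef X).trace_nonneg).1

lemma traceNorm_nonneg [DecidableEq n] (X : Matrix n n ℂ) : 0 ≤ traceNorm X :=
  trace_sqrt_re_nonneg _

/-- Contractions `K` pair with `Y` to at most the sum of the singular values of `Y`. -/
lemma trace_mul_re_le_trace_sqrt [DecidableEq n] (Y : Matrix m n ℂ) (K : Matrix n m ℂ)
    (hK : ∀ M : Matrix m n ℂ, hsNorm (K * M) ≤ hsNorm M) :
    (K * Y).trace.re ≤ (CFC.sqrt (Yᴴ * Y)).trace.re := by
  obtain ⟨V, hV, -, hVY⟩ := exists_polar Y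
  set S := CFC.sqrt (Yᴴ * Y)
  set s := CFC.sqrt S with hs
  have hss : s * s = S := sqrt_mul_sqrt (sqrt_posSemidef _)
  have h1 : (K * Y).trace = (s * (K * (V * s))).trace := by
    rw [Matrix.trace_mul_comm s, ← hVY, ← hss]
    simp only [Matrix.mul_assoc]
  have h2 : hsNorm s ^ 2 = S.trace.re := by
    rw [hsNorm_sq_eq_trace, hs, sqrt_isHermitian, ← hs, hss]
  calc (K * Y).trace.re ≤ ‖(K * Y).trace‖ := Complex.re_le_norm _
    _ ≤ hsNorm s * hsNorm (K * (V * s)) := by rw [h1]; exact norm_trace_mul_le _ _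
    _ ≤ hsNorm s * hsNorm s := by
        gcongr
        · exact hsNorm_nonneg _
        · exact (hK _).trans (hsNorm_mul_le_of_isPartialIsometry hV _)
    _ = S.trace.re := by rw [← sq, h2]

lemma trace_mul_re_le_traceNorm [DecidableEq n] {K : Matrix n n ℂ} (hK : IsPartialIsometry K)
    (X : Matrix n n ℂ) : (K * X).trace.re ≤ traceNorm X :=
  trace_mul_re_le_trace_sqrt X K fun M => hsNorm_mul_le_of_isPartialIsometry hK M

lemma exists_traceNorm_eq [DecidableEq n] (X : Matrix n n ℂ) :
    ∃ K : Matrix n n ℂ, IsPartialIsometry K ∧ (K * X).trace.re = traceNorm X := by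
  obtain ⟨V, hV, h, -⟩ := exists_polar X
  exact ⟨Vᴴ, hV.conjTranspose, by rw [h]; rfl⟩

lemma traceNorm_add_le [DecidableEq n] (X Y : Matrix n n ℂ) :
    traceNorm (X + Y) ≤ traceNorm X + traceNorm Y := by
  obtain ⟨K, hK, h⟩ := exists_traceNorm_eq (X + Y)
  rw [← h, Matrix.mul_add, Matrix.trace_add, Complex.add_re]
  exact add_le_add (trace_mul_re_le_traceNorm hK X) (trace_mul_re_le_traceNorm hK Y)

lemma traceNorm_neg [DecidableEq n] (X : Matrix n n ℂ) : traceNorm (-X) = traceNorm X := by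
  simp [traceNorm]

lemma traceNorm_sub_comm [DecidableEq n] (X Y : Matrix n n ℂ) :
    traceNorm (X - Y) = traceNorm (Y - X) := by
  rw [← traceNorm_neg, neg_sub]

lemma traceNorm_sub_le [DecidableEq n] (X Y Z : Matrix n n ℂ) :
    traceNorm (X - Z) ≤ traceNorm (X - Y) + traceNorm (Y - Z) := by
  simpa using traceNorm_add_le (X - Y) (Y - Z)

lemma traceNorm_of_posSemidef [DecidableEq n] {X : Matrix n n ℂ} (hX : X.PosSemidef) :
    traceNorm X = X.trace.re := by
  rw [traceNorm, hX.isHermitian.eq, sqrt_eq_of_mul_self hX rfl]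

lemma traceNorm_smul_of_nonneg [DecidableEq n] {c : ℝ} (hc : 0 ≤ c) (X : Matrix n n ℂ) :
    traceNorm ((c : ℂ) • X) = c * traceNorm X := by
  have h : CFC.sqrt (((c : ℂ) • X)ᴴ * ((c : ℂ) • X)) = (c : ℂ) • CFC.sqrt (Xᴴ * X) := by
    apply sqrt_eq_of_mul_self
    · exact (sqrt_posSemidef _).smul (Complex.zero_le_real.2 hc)
    · rw [Matrix.smul_mul, Matrix.mul_smul,
        sqrt_mul_sqrt (Matrix.posSemidef_conjTranspose_mul_self X)]
      simp [Matrix.conjTranspose_smul]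
  rw [traceNorm, h, Matrix.trace_smul, smul_eq_mul, Complex.re_ofReal_mul, traceNorm]

lemma traceNorm_sum_le [DecidableEq n] {ι : Type*} (s : Finset ι) (f : ι → Matrix n n ℂ) :
    traceNorm (∑ i ∈ s, f i) ≤ ∑ i ∈ s, traceNorm (f i) := by
  classical
  induction s using Finset.induction_on with
  | empty =>
    have := traceNorm_of_posSemidef (n := n) Matrix.PosSemidef.zero
    simp [this]
  | insert a s ha ih =>
    rw [Finset.sum_insert ha, Finset.sum_insert ha]
    exact (traceNorm_add_le _ _).trans (by gcongr)

/-- If `A` and `B` purify two positive operators, the distance of these is controlled by the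
distance of the purifications. This plays the part of the monotonicity of the trace norm under
partial traces throughout. -/
lemma traceNorm_mul_conjTranspose_sub_le [DecidableEq m] (A B : Matrix m n ℂ) :
    traceNorm (A * Aᴴ - B * Bᴴ) ≤ hsNorm (A - B) * hsNorm (A + B) := by
  obtain ⟨K, hK, h⟩ := exists_traceNorm_eq (A * Aᴴ - B * Bᴴ)
  have h1 : (2 : ℂ) * (K * (A * Aᴴ - B * Bᴴ)).trace
      = (K * (A - B) * (A + B)ᴴ).trace + (K * (A + B) * (A - B)ᴴ).trace := by
    rw [← Matrix.trace_add, ← smul_eq_mul, ← Matrix.trace_smul]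
    congr 1
    simp only [Matrix.mul_assoc, ← Matrix.mul_add, ← Matrix.mul_smul]
    congr 1
    rw [two_smul]
    simp only [Matrix.conjTranspose_add, Matrix.conjTranspose_sub, Matrix.mul_add, Matrix.add_mul,
      Matrix.sub_mul, Matrix.mul_sub]
    abel
  have h2 : ∀ C D : Matrix m n ℂ, (K * C * Dᴴ).trace.re ≤ hsNorm C * hsNorm D := fun C D => by
    refine (Complex.re_le_norm _).trans ((norm_trace_mul_le _ _).trans ?_)
    rw [hsNorm_conjTranspose]
    exact mul_le_mul_of_nonneg_right (hsNorm_mul_le_of_isPartialIsometry hK _) (hsNorm_nonneg _)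
  have h3 := congrArg Complex.re h1
  rw [Complex.add_re, ← Complex.ofReal_ofNat, Complex.re_ofReal_mul, h] at h3
  have := h2 (A - B) (A + B)
  have := h2 (A + B) (A - B)
  linarith

/-- The Cauchy–Schwarz bound for the trace norm, weighted by a Hermitian operator `T`. -/
lemma traceNorm_mul_mul_le [DecidableEq n] {T : Matrix n n ℂ} (hT : Tᴴ = T) (Z : Matrix n n ℂ) :
    traceNorm (T * Z * T) ≤ hsNorm (T * T) * hsNorm Z := by
  obtain ⟨K, hK, h⟩ := exists_traceNorm_eq (T * Z * T)
  have h1 : (K * (T * Z * T)).trace = (T * K * T * Z).trace := by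
    rw [← Matrix.mul_assoc, Matrix.trace_mul_comm]
    simp only [Matrix.mul_assoc]
  have h2 : hsNorm (T * K * T) ≤ hsNorm (T * T) := by
    rw [← sq_le_sq₀ (hsNorm_nonneg _) (hsNorm_nonneg _), hsNorm_sq_eq_trace]
    have : ((T * K * T)ᴴ * (T * K * T)).trace = ((T * T * Kᴴ) * (T * T * K)).trace := by
      have e : (T * K * T)ᴴ * (T * K * T) = T * Kᴴ * T * (T * K) * T := by
        simp only [Matrix.conjTranspose_mul, hT, Matrix.mul_assoc]
      rw [e, Matrix.trace_mul_comm]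
      simp only [Matrix.mul_assoc]
    rw [this, sq]
    refine (Complex.re_le_norm _).trans ((norm_trace_mul_le _ _).trans ?_)
    exact mul_le_mul (hsNorm_mul_le_of_isPartialIsometry_right hK.conjTranspose _)
      (hsNorm_mul_le_of_isPartialIsometry_right hK _) (hsNorm_nonneg _) (hsNorm_nonneg _)
  rw [← h, h1]
  refine (Complex.re_le_norm _).trans ((norm_trace_mul_le _ _).trans ?_)
  exact mul_le_mul_of_nonneg_right h2 (hsNorm_nonneg _)

lemma trace_mul_re_nonneg [DecidableEq n] {X Y : Matrix n n ℂ} (hX : X.PosSemidef)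
    (hY : Y.PosSemidef) : 0 ≤ (X * Y).trace.re := by
  have h1 : (X * Y).trace = ((CFC.sqrt X)ᴴ * Y * CFC.sqrt X).trace := by
    rw [Matrix.trace_mul_comm (_ * Y), sqrt_isHermitian, ← Matrix.mul_assoc, sqrt_mul_sqrt hX]
  rw [h1]
  exact (Complex.le_def.1 (hY.conjTranspose_mul_mul_same _).trace_nonneg).1

/-- The Powers–Størmer inequality. -/
lemma hsNorm_sub_sq_le_traceNorm [DecidableEq n] {P Q : Matrix n n ℂ} (hP : P.PosSemidef)
    (hQ : Q.PosSemidef) : hsNorm (P - Q) ^ 2 ≤ traceNorm (P * P - Q * Q) := by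
  set D := P - Q with hDdef
  have hDH : Dᴴ = D := by
    rw [hDdef, Matrix.conjTranspose_sub, hP.isHermitian.eq, hQ.isHermitian.eq]
  have hD : IsSelfAdjoint D := hDH
  have hc := fun f : ℝ → ℝ => continuousOn_spectrum f D
  -- `W` is the sign of `D`, and `Dp - Dn = D`, `Dp + Dn = |D|`
  set W := cfc (fun x : ℝ => SignType.sign x : ℝ → ℝ) D with hW
  set Dp := cfc (fun x : ℝ => max x 0) D with hDp
  set Dn := cfc (fun x : ℝ => max (-x) 0) D with hDn
  have hid : D = cfc (fun x : ℝ => x) D := (cfc_id' ℝ D).symm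
  have hsub : Dp - Dn = D := by
    rw [hDp, hDn, ← cfc_sub _ _ D (hc _) (hc _)]
    conv_rhs => rw [hid]
    refine cfc_congr fun x _ => ?_
    rcases le_total x 0 with h | h <;> simp [h]
  have habs : Dp + Dn = cfc (fun x : ℝ => |x|) D := by
    rw [hDp, hDn, ← cfc_add D _ _ (hc _) (hc _)]
    refine cfc_congr fun x _ => ?_
    rcases le_total x 0 with h | h <;> simp [h, abs_of_nonneg, abs_of_nonpos]
  have hWD : W * D = Dp + Dn := by
    have : W * D = W * cfc (fun x : ℝ => x) D := by rw [← hid]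
    rw [this, habs, hW, ← cfc_mul _ _ D (hc _) (hc _)]
    exact cfc_congr fun x _ => sign_mul_self x
  have hDW : D * W = Dp + Dn := by
    have : D * W = cfc (fun x : ℝ => x) D * W := by rw [← hid]
    rw [this, habs, hW, ← cfc_mul _ _ D (hc _) (hc _)]
    exact cfc_congr fun x _ => self_mul_sign x
  have hWsa : Wᴴ = W := (cfc_predicate _ D : IsSelfAdjoint W)
  have hWW : IsIdempotentElem (W * W) := by
    rw [IsIdempotentElem, hW, ← cfc_mul _ _ D (hc _) (hc _), ← cfc_mul _ _ D (hc _) (hc _)]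
    refine cfc_congr fun x _ => ?_
    rcases lt_trichotomy x 0 with h | h | h <;> simp [h]
  have hWp : IsPartialIsometry W := by
    rw [IsPartialIsometry, hWsa]
    exact ⟨hWW, hWW⟩
  have hDp0 : Dp.PosSemidef :=
    Matrix.nonneg_iff_posSemidef.1 (cfc_nonneg fun x _ => le_max_right _ _)
  have hDn0 : Dn.PosSemidef :=
    Matrix.nonneg_iff_posSemidef.1 (cfc_nonneg fun x _ => le_max_right _ _)
  have h1 : (W * (P * P - Q * Q)).trace = (Dp * P + Dp * Q + Dn * P + Dn * Q).trace := by
    have e : (2 : ℂ) • (P * P - Q * Q) = D * (P + Q) + (P + Q) * D := by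
      rw [hDdef, two_smul]
      simp only [Matrix.mul_add, Matrix.add_mul, Matrix.sub_mul, Matrix.mul_sub]
      abel
    have e2 : (2 : ℂ) * (W * (P * P - Q * Q)).trace
        = 2 * (Dp * P + Dp * Q + Dn * P + Dn * Q).trace := by
      rw [← smul_eq_mul, ← Matrix.trace_smul, ← Matrix.mul_smul, e, Matrix.mul_add,
        Matrix.trace_add, ← Matrix.mul_assoc, hWD, ← Matrix.mul_assoc, Matrix.trace_mul_comm _ D,
        ← Matrix.mul_assoc, hDW, two_mul, ← Matrix.trace_add, ← Matrix.trace_add]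
      simp only [Matrix.mul_add, Matrix.add_mul]
      congr 1
      abel
    exact mul_left_cancel₀ two_ne_zero e2
  have h2 : hsNorm D ^ 2 = (Dp * P - Dp * Q - Dn * P + Dn * Q).trace.re := by
    rw [hsNorm_sq_eq_trace, hDH]
    congr 2
    conv_lhs => rw [← hsub, hsub]
    nth_rewrite 1 [← hsub]
    rw [hDdef]
    simp only [Matrix.sub_mul, Matrix.mul_sub]
    abel
  have h3 := trace_mul_re_nonneg hDp0 hQ
  have h4 := trace_mul_re_nonneg hDn0 hP
  have h5 := trace_mul_re_le_traceNorm hWp (P * P - Q * Q)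
  rw [h1] at h5
  simp only [Matrix.trace_add, Matrix.trace_sub, Complex.add_re, Complex.sub_re] at h5 h2
  linarith

/-- Uhlmann's theorem, quantitatively: two operators `Φ Φ†` and `Ψ Ψ†` that are close in trace
norm have purifications `Φ` and `Ψ V` that are close in Hilbert–Schmidt norm. -/
lemma exists_uhlmann [DecidableEq l] [DecidableEq m] [DecidableEq n] (Φ : Matrix n m ℂ)
    (Ψ : Matrix n l ℂ) :
    ∃ V : Matrix l m ℂ, IsPartialIsometry V ∧
      hsNorm Φ ^ 2 + hsNorm Ψ ^ 2 - traceNorm (Φ * Φᴴ - Ψ * Ψᴴ)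
        ≤ 2 * (Φᴴ * (Ψ * V)).trace.re := by
  obtain ⟨V, hV, hV1, -⟩ := exists_polar (Ψᴴ * Φ)
  obtain ⟨V₁, hV₁, h₁, h₁'⟩ := exists_polar Φᴴ
  obtain ⟨V₂, hV₂, h₂, h₂'⟩ := exists_polar Ψᴴ
  rw [Matrix.conjTranspose_conjTranspose] at h₁ h₁' h₂ h₂'
  refine ⟨V, hV, ?_⟩
  set P := CFC.sqrt (Φ * Φᴴ) with hP
  set Q := CFC.sqrt (Ψ * Ψᴴ) with hQ
  have hPH : Pᴴ = P := sqrt_isHermitian _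
  have hQH : Qᴴ = Q := sqrt_isHermitian _
  have hPP : P * P = Φ * Φᴴ := sqrt_mul_sqrt (Matrix.posSemidef_self_mul_conjTranspose Φ)
  have hQQ : Q * Q = Ψ * Ψᴴ := sqrt_mul_sqrt (Matrix.posSemidef_self_mul_conjTranspose Ψ)
  have hps := hsNorm_sub_sq_le_traceNorm (sqrt_posSemidef (Φ * Φᴴ)) (sqrt_posSemidef (Ψ * Ψᴴ))
  rw [← hP, ← hQ, hsNorm_sub_sq, hPP, hQQ, hsNorm_sq_eq_trace P, hsNorm_sq_eq_trace Q, hPH, hQH,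
    hPP, hQQ, ← hsNorm_sq_eq_trace', ← hsNorm_sq_eq_trace'] at hps
  have hK := trace_mul_re_le_trace_sqrt (Ψᴴ * Φ) (V₁ * V₂ᴴ) fun M => by
    rw [Matrix.mul_assoc]
    exact (hsNorm_mul_le_of_isPartialIsometry hV₁ _).trans
      (hsNorm_mul_le_of_isPartialIsometry hV₂.conjTranspose _)
  have e1 : (V₁ * V₂ᴴ * (Ψᴴ * Φ)).trace = (Q * P).trace := by
    have e : P * V₁ᴴ = Φ := by
      have := congrArg Matrix.conjTranspose h₁'
      rwa [Matrix.conjTranspose_mul, Matrix.conjTranspose_conjTranspose, hPH] at this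
    have e' : Φ * V₁ = P := by
      have := congrArg Matrix.conjTranspose h₁
      rwa [Matrix.conjTranspose_mul, Matrix.conjTranspose_conjTranspose,
        Matrix.conjTranspose_conjTranspose, hPH] at this
    rw [Matrix.mul_assoc, ← Matrix.mul_assoc V₂ᴴ, h₂, Matrix.trace_mul_comm, Matrix.mul_assoc, e']
  have e2 : (Φᴴ * (Ψ * V)).trace.re = (Vᴴ * (Ψᴴ * Φ)).trace.re := by
    have : Φᴴ * (Ψ * V) = (Vᴴ * (Ψᴴ * Φ))ᴴ := by
      simp [Matrix.conjTranspose_mul, Matrix.mul_assoc]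
    rw [this, Matrix.trace_conjTranspose]
    simp
  have e3 : (Q * P).trace = (P * Q).trace := Matrix.trace_mul_comm _ _
  rw [e1, ← hV1, ← e2, e3] at hK
  linarith

end TraceNorm

/-! ### Random phases -/

section Phases

variable {P : Type*} [Fintype P] [DecidableEq P]

/-- The character `f ↦ exp (2πi (v · f) / 3)` of the group of functions `P → ℤ/3`. -/
def phaseChar (v f : P → ZMod 3) : ℂ := ZMod.stdAddChar (v ⬝ᵥ f)

/-- The phase `exp (2πi f(p) / 3)`. For a uniformly random `f` these are independent phases with
vanishing first and second moments. -/
def phase (f : P → ZMod 3) (p : P) : ℂ := ZMod.stdAddChar (f p)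

lemma phase_eq_phaseChar (f : P → ZMod 3) (p : P) : phase f p = phaseChar (Pi.single p 1) f := by
  simp [phase, phaseChar]

omit [DecidableEq P] in
lemma phaseChar_mul_star (v w f : P → ZMod 3) :
    phaseChar v f * star (phaseChar w f) = phaseChar (v - w) f := by
  have : star (phaseChar w f) = ZMod.stdAddChar (-(w ⬝ᵥ f)) := by
    rw [AddChar.map_neg_eq_conj]; rfl
  rw [this, phaseChar, phaseChar, ← AddChar.map_add_eq_mul, sub_dotProduct, sub_eq_add_neg]

lemma sum_phaseChar (v : P → ZMod 3) :
    ∑ f, phaseChar v f = if v = 0 then (Fintype.card (P → ZMod 3) : ℂ) else 0 := by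
  split_ifs with h
  · simp [h, phaseChar]
  · let φ : (P → ZMod 3) →+ ZMod 3 := AddMonoidHom.mk' (fun f => v ⬝ᵥ f) (dotProduct_add v)
    have h1 : ZMod.stdAddChar.compAddMonoidHom φ ≠ (0 : AddChar (P → ZMod 3) ℂ) := by
      intro h0
      obtain ⟨p, hp⟩ := Function.ne_iff.1 h
      have h2 := DFunLike.congr_fun h0 (Pi.single p 1)
      have h3 : ZMod.stdAddChar (N := 3) (v p) = ZMod.stdAddChar (N := 3) 0 := by
        simpa [φ] using h2
      exact hp (ZMod.injective_stdAddChar h3)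
    exact AddChar.sum_eq_zero_iff_ne_zero.2 h1

/-- Orthogonality of characters, as a statement on second moments of trigonometric sums. -/
lemma sum_norm_sq_sum_phaseChar {ι : Type*} (s : Finset ι) (v : ι → P → ZMod 3)
    (hv : Set.InjOn v s) (c : ι → ℂ) :
    ∑ f, ‖∑ j ∈ s, phaseChar (v j) f * c j‖ ^ 2
      = Fintype.card (P → ZMod 3) * ∑ j ∈ s, ‖c j‖ ^ 2 := by
  have key : ∀ f, ((‖∑ j ∈ s, phaseChar (v j) f * c j‖ ^ 2 : ℝ) : ℂ)
      = ∑ j ∈ s, ∑ k ∈ s, phaseChar (v j - v k) f * (c j * star (c k)) := by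
    intro f
    rw [Complex.ofReal_pow, ← Complex.mul_conj', map_sum, Finset.sum_mul_sum]
    refine Finset.sum_congr rfl fun j _ => Finset.sum_congr rfl fun k _ => ?_
    rw [← phaseChar_mul_star, map_mul, ← Complex.star_def]
    ring
  apply Complex.ofReal_injective
  rw [Complex.ofReal_sum, Finset.sum_congr rfl fun f _ => key f, Finset.sum_comm]
  push_cast
  rw [Finset.mul_sum]
  refine Finset.sum_congr rfl fun j hj => ?_
  rw [Finset.sum_comm, Finset.sum_eq_single_of_mem j hj]
  · rw [← Finset.sum_mul, sum_phaseChar, if_pos (sub_self _), Complex.star_def, Complex.mul_conj']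
  · intro k hk hkj
    rw [← Finset.sum_mul, sum_phaseChar, if_neg, zero_mul]
    exact fun h => hkj (hv hk hj (sub_eq_zero.1 h).symm)

lemma sum_norm_sq_sum_phase (c : P → ℂ) :
    ∑ f, ‖∑ p, phase f p * c p‖ ^ 2 = Fintype.card (P → ZMod 3) * ∑ p, ‖c p‖ ^ 2 := by
  rw [← sum_norm_sq_sum_phaseChar Finset.univ (fun p => Pi.single p 1) _ c]
  · simp only [phase_eq_phaseChar]
  · intro p _ q _ h
    by_contra hpq
    have := congrFun h p
    simp [Pi.single_eq_of_ne hpq] at this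

omit [Fintype P] in
lemma single_sub_single_injOn :
    Set.InjOn (fun x : P × P => (Pi.single x.1 1 - Pi.single x.2 1 : P → ZMod 3))
      {x | x.1 ≠ x.2} := by
  rintro ⟨p, q⟩ hpq ⟨r, s⟩ hrs h
  have hp := congrFun h p
  have hq := congrFun h q
  simp only [Pi.sub_apply, Pi.single_apply, if_true] at hp hq
  replace hpq : p ≠ q := hpq
  replace hrs : r ≠ s := hrs
  rw [if_neg hpq] at hp
  rw [if_neg hpq.symm] at hq
  have hpr : p = r := by
    by_contra hpr
    rw [if_neg hpr] at hp
    split_ifs at hp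
    -- `1 ≠ -1` in `ℤ/3` excludes that the two pairs are swapped
    · exact absurd hp (by decide)
    · exact absurd hp (by decide)
  subst hpr
  have hqs : q = s := by
    by_contra hqs
    rw [if_neg hpq.symm, if_neg hqs] at hq
    exact absurd hq (by decide)
  rw [hqs]

/-- In the sesquilinear form `∑ g_p ḡ_q k_{pq}` in random phases, the diagonal is not random, and
the off-diagonal terms are pairwise uncorrelated. -/
lemma sum_norm_sq_phase_form_le (k : P → P → ℂ) :
    ∑ f, ‖∑ p, ∑ q, phase f p * star (phase f q) * k p q - ∑ p, k p p‖ ^ 2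
      ≤ Fintype.card (P → ZMod 3) * ∑ p, ∑ q, ‖k p q‖ ^ 2 := by
  have key : ∀ f, ∑ p, ∑ q, phase f p * star (phase f q) * k p q - ∑ p, k p p
      = ∑ x : P × P with x.1 ≠ x.2,
        phaseChar (Pi.single x.1 1 - Pi.single x.2 1) f * k x.1 x.2 := by
    intro f
    rw [sub_eq_iff_eq_add]
    have h1 : ∑ p, k p p = ∑ x : P × P with ¬ x.1 ≠ x.2,
        phaseChar (Pi.single x.1 1 - Pi.single x.2 1) f * k x.1 x.2 := by
      rw [Finset.sum_filter, Fintype.sum_prod_type]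
      refine Finset.sum_congr rfl fun p _ => ?_
      simp [phaseChar]
    rw [h1, Finset.sum_filter_add_sum_filter_not, Fintype.sum_prod_type]
    simp only [← phaseChar_mul_star, phase_eq_phaseChar]
  rw [Finset.sum_congr rfl fun f _ => by rw [key f], sum_norm_sq_sum_phaseChar]
  · gcongr
    rw [← Fintype.sum_prod_type']
    exact Finset.sum_le_sum_of_subset_of_nonneg (Finset.filter_subset _ _)
      fun _ _ _ => by positivity
  · exact single_sub_single_injOn.mono (by simp)

lemma sum_phase_mul_star (p q : P) :
    ∑ f, phase f p * star (phase f q)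
      = if p = q then (Fintype.card (P → ZMod 3) : ℂ) else 0 := by
  simp only [phase_eq_phaseChar, phaseChar_mul_star, sum_phaseChar]
  by_cases h : p = q
  · simp [h]
  · rw [if_neg h, if_neg]
    intro h0
    have := congrFun h0 p
    simp [Pi.single_eq_of_ne h] at this

end Phases

/-! ### Decoupling by random phases -/

section Decoupling

variable {a e i r κ μ : Type*} [Fintype a] [Fintype e] [Fintype i] [Fintype r] [Fintype κ]
  [Fintype μ]

/-- The block `(⟨j| ⊗ 1) X (|k⟩ ⊗ 1)` of a bipartite operator. -/
def block (X : Matrix (a × r) (a × r) ℂ) (j k : a) : Matrix r r ℂ := fun x y => X (j, x) (k, y)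

lemma sum_mul_sum_prod_comm (α : i → e → ℝ)
    (β : a → r → ℝ) : (∑ j, ∑ x, α j x) * (∑ k, ∑ y, β k y)
      = ∑ z : e × r, ∑ p : i × a, α p.1 z.1 * β p.2 z.2 := by
  simp only [Fintype.sum_prod_type, ← Finset.sum_mul_sum]
  rw [Finset.sum_comm, Finset.sum_comm (f := β)]

/-- The operator `∑ g_{ia} ḡ_{jb} ω_{ij} ⊗ ρ_{ab}`. If `ω` is the Choi operator of a map `T`, this
is `T` applied to the system `a` of `ρ` after the conjugation with the matrix `g`. -/
def twist (g : i × a → ℂ) (ω : Matrix (i × e) (i × e) ℂ) (ρ : Matrix (a × r) (a × r) ℂ) :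
    Matrix (e × r) (e × r) ℂ :=
  ∑ p, ∑ q, (g p * star (g q)) • (block ω p.1 q.1 ⊗ₖ block ρ p.2 q.2)

/-- The purification of `twist g (A A†) (C C†)` that comes from `A` and `C`. -/
def twistSqrt (g : i × a → ℂ) (A : Matrix (i × e) κ ℂ) (C : Matrix (a × r) μ ℂ) :
    Matrix (e × r) (κ × μ) ℂ :=
  fun x y => ∑ p, g p * (A (p.1, x.1) y.1 * C (p.2, x.2) y.2)

omit [Fintype e] [Fintype r] in
lemma twist_apply (g : i × a → ℂ) (ω : Matrix (i × e) (i × e) ℂ) (ρ : Matrix (a × r) (a × r) ℂ)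
    (x y : e × r) : twist g ω ρ x y = ∑ p, ∑ q, g p * star (g q) *
      (ω (p.1, x.1) (q.1, y.1) * ρ (p.2, x.2) (q.2, y.2)) := by
  simp only [twist, Matrix.sum_apply, Matrix.smul_apply, smul_eq_mul, Matrix.kroneckerMap_apply,
    block]

omit [Fintype e] [Fintype r] in
lemma twistSqrt_mul_conjTranspose (g : i × a → ℂ) (A : Matrix (i × e) κ ℂ)
    (C : Matrix (a × r) μ ℂ) :
    twistSqrt g A C * (twistSqrt g A C)ᴴ = twist g (A * Aᴴ) (C * Cᴴ) := by
  ext x y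
  rw [twist_apply, Matrix.mul_apply]
  simp only [twistSqrt, Matrix.conjTranspose_apply, star_sum, Finset.sum_mul_sum]
  rw [Finset.sum_comm]
  refine Finset.sum_congr rfl fun p _ => ?_
  rw [Finset.sum_comm]
  refine Finset.sum_congr rfl fun q _ => ?_
  simp only [Matrix.mul_apply, Matrix.conjTranspose_apply]
  rw [Finset.sum_mul_sum, Fintype.sum_prod_type, Finset.mul_sum]
  refine Finset.sum_congr rfl fun k _ => ?_
  rw [Finset.mul_sum]
  refine Finset.sum_congr rfl fun l _ => ?_
  simp only [star_mul']
  ring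

omit [Fintype e] [Fintype r] [Fintype κ] [Fintype μ] in
lemma twistSqrt_sub_left (g : i × a → ℂ) (A B : Matrix (i × e) κ ℂ) (C : Matrix (a × r) μ ℂ) :
    twistSqrt g (A - B) C = twistSqrt g A C - twistSqrt g B C := by
  ext x y
  simp [twistSqrt, sub_mul, mul_sub, Finset.sum_sub_distrib]

omit [Fintype e] [Fintype r] [Fintype κ] [Fintype μ] in
lemma twistSqrt_add_left (g : i × a → ℂ) (A B : Matrix (i × e) κ ℂ) (C : Matrix (a × r) μ ℂ) :
    twistSqrt g (A + B) C = twistSqrt g A C + twistSqrt g B C := by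
  ext x y
  simp [twistSqrt, add_mul, mul_add, Finset.sum_add_distrib]

omit [Fintype e] [Fintype r] [Fintype κ] [Fintype μ] in
lemma twistSqrt_sub_right (g : i × a → ℂ) (A : Matrix (i × e) κ ℂ) (C D : Matrix (a × r) μ ℂ) :
    twistSqrt g A (C - D) = twistSqrt g A C - twistSqrt g A D := by
  ext x y
  simp [twistSqrt, mul_sub, Finset.sum_sub_distrib]

omit [Fintype e] [Fintype r] [Fintype κ] [Fintype μ] in
lemma twistSqrt_add_right (g : i × a → ℂ) (A : Matrix (i × e) κ ℂ) (C D : Matrix (a × r) μ ℂ) :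
    twistSqrt g A (C + D) = twistSqrt g A C + twistSqrt g A D := by
  ext x y
  simp [twistSqrt, mul_add, Finset.sum_add_distrib]

variable [DecidableEq a] [DecidableEq i]

lemma sum_hsNorm_twistSqrt_sq (A : Matrix (i × e) κ ℂ) (C : Matrix (a × r) μ ℂ) :
    ∑ f : i × a → ZMod 3, hsNorm (twistSqrt (phase f) A C) ^ 2
      = Fintype.card (i × a → ZMod 3) * (hsNorm A ^ 2 * hsNorm C ^ 2) := by
  have h1 : hsNorm A ^ 2 * hsNorm C ^ 2
      = ∑ x : e × r, ∑ y : κ × μ, ∑ p : i × a,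
        ‖A (p.1, x.1) y.1 * C (p.2, x.2) y.2‖ ^ 2 := by
    rw [hsNorm_sq, hsNorm_sq, Fintype.sum_prod_type, Fintype.sum_prod_type (α₁ := a),
      sum_mul_sum_prod_comm]
    refine Finset.sum_congr rfl fun x _ => ?_
    rw [Finset.sum_comm]
    refine Finset.sum_congr rfl fun p _ => ?_
    simp only [Finset.sum_mul_sum, Fintype.sum_prod_type, norm_mul, mul_pow]
  rw [h1]
  simp only [hsNorm_sq, Finset.mul_sum]
  rw [Finset.sum_comm]
  refine Finset.sum_congr rfl fun x _ => ?_
  rw [Finset.sum_comm]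
  refine Finset.sum_congr rfl fun y _ => ?_
  rw [← Finset.mul_sum]
  exact sum_norm_sq_sum_phase fun p : i × a => A (p.1, x.1) y.1 * C (p.2, x.2) y.2

omit [Fintype e] [Fintype r] in
lemma sum_twist_phase (ω : Matrix (i × e) (i × e) ℂ) (ρ : Matrix (a × r) (a × r) ℂ) :
    ∑ f : i × a → ZMod 3, twist (phase f) ω ρ
      = (Fintype.card (i × a → ZMod 3) : ℂ) • (traceFst ω ⊗ₖ traceFst ρ) := by
  ext x y
  simp only [Matrix.sum_apply, twist_apply, Matrix.smul_apply, smul_eq_mul,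
    Matrix.kroneckerMap_apply, traceFst]
  have h : (∑ k, ω (k, x.1) (k, y.1)) * (∑ k, ρ (k, x.2) (k, y.2))
      = ∑ p : i × a, ω (p.1, x.1) (p.1, y.1) * ρ (p.2, x.2) (p.2, y.2) := by
    rw [Finset.sum_mul_sum, Fintype.sum_prod_type]
  rw [Finset.sum_comm, h, Finset.mul_sum]
  refine Finset.sum_congr rfl fun p _ => ?_
  rw [Finset.sum_comm, Finset.sum_eq_single_of_mem p (Finset.mem_univ _)]
  · rw [← Finset.sum_mul, sum_phase_mul_star, if_pos rfl]
  · intro q _ hq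
    rw [← Finset.sum_mul, sum_phase_mul_star, if_neg hq.symm, zero_mul]

lemma sum_hsNorm_twist_sub_sq_le (ω : Matrix (i × e) (i × e) ℂ) (ρ : Matrix (a × r) (a × r) ℂ) :
    ∑ f : i × a → ZMod 3, hsNorm (twist (phase f) ω ρ - traceFst ω ⊗ₖ traceFst ρ) ^ 2
      ≤ Fintype.card (i × a → ZMod 3) * (hsNorm ω ^ 2 * hsNorm ρ ^ 2) := by
  have h1 : hsNorm ω ^ 2 * hsNorm ρ ^ 2
      = ∑ x : e × r, ∑ y : e × r, ∑ p : i × a, ∑ q : i × a,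
        ‖ω (p.1, x.1) (q.1, y.1) * ρ (p.2, x.2) (q.2, y.2)‖ ^ 2 := by
    rw [hsNorm_sq, hsNorm_sq, Fintype.sum_prod_type, Fintype.sum_prod_type (α₁ := a),
      sum_mul_sum_prod_comm]
    refine Finset.sum_congr rfl fun x _ => ?_
    rw [Finset.sum_comm]
    refine Finset.sum_congr rfl fun p _ => ?_
    rw [Fintype.sum_prod_type, Fintype.sum_prod_type (α₁ := a), sum_mul_sum_prod_comm]
    simp only [norm_mul, mul_pow]
  rw [h1]
  simp only [hsNorm_sq, Finset.mul_sum]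
  rw [Finset.sum_comm]
  refine Finset.sum_le_sum fun x _ => ?_
  rw [Finset.sum_comm]
  refine Finset.sum_le_sum fun y _ => ?_
  simp only [← Finset.mul_sum]
  refine le_of_eq_of_le ?_ (sum_norm_sq_phase_form_le fun p q : i × a =>
    ω (p.1, x.1) (q.1, y.1) * ρ (p.2, x.2) (q.2, y.2))
  refine Finset.sum_congr rfl fun f _ => ?_
  rw [Matrix.sub_apply, twist_apply, Matrix.kroneckerMap_apply, traceFst, traceFst,
    Finset.sum_mul_sum, ← Fintype.sum_prod_type' (α₁ := i)]

lemma block_conj (S : Matrix r r ℂ) (X : Matrix (a × r) (a × r) ℂ) (j k : a) :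
    block ((1 : Matrix a a ℂ) ⊗ₖ S * X * (1 : Matrix a a ℂ) ⊗ₖ S) j k = S * block X j k * S := by
  ext x y
  simp [block, Matrix.mul_apply, Fintype.sum_prod_type, Matrix.one_apply, Finset.sum_mul, ite_mul]

lemma twist_conj (g : i × a → ℂ) (S : Matrix e e ℂ) (T : Matrix r r ℂ)
    (ω : Matrix (i × e) (i × e) ℂ) (ρ : Matrix (a × r) (a × r) ℂ) :
    twist g ((1 : Matrix i i ℂ) ⊗ₖ S * ω * (1 : Matrix i i ℂ) ⊗ₖ S)
      ((1 : Matrix a a ℂ) ⊗ₖ T * ρ * (1 : Matrix a a ℂ) ⊗ₖ T)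
      = (S ⊗ₖ T) * twist g ω ρ * (S ⊗ₖ T) := by
  simp only [twist, block_conj, Finset.mul_sum, Finset.sum_mul, Matrix.mul_kronecker_mul,
    Matrix.mul_smul, Matrix.smul_mul]

end Decoupling

section Average

variable {a e i r κ μ : Type*} [Fintype a] [Fintype e] [Fintype i] [Fintype r] [Fintype κ]
  [Fintype μ] [DecidableEq a] [DecidableEq e] [DecidableEq i] [DecidableEq r]

/-- The quantity `tr [((1 ⊗ S)^{-1/2} ρ)²]` whose infimum over `S` defines the 2-entropy. -/
def collision (ρ : Matrix (a × r) (a × r) ℂ) (S : Matrix r r ℂ) : ℝ :=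
  ((((CFC.sqrt ((1 : Matrix a a ℂ) ⊗ₖ S))⁻¹ * ρ) ^ 2).trace.re)

lemma sqrt_one_kronecker {S : Matrix r r ℂ} (hS : S.PosSemidef) :
    CFC.sqrt ((1 : Matrix a a ℂ) ⊗ₖ S) = (1 : Matrix a a ℂ) ⊗ₖ CFC.sqrt S := by
  apply sqrt_eq_of_mul_self
  · exact Matrix.PosSemidef.one.kronecker (sqrt_posSemidef S)
  · rw [← Matrix.mul_kronecker_mul, sqrt_mul_sqrt hS, Matrix.one_mul]

lemma isUnit_det_sqrt {S : Matrix r r ℂ} (hS : S.PosDef) : IsUnit (CFC.sqrt S).det := by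
  have h : IsUnit S.det := (Matrix.isUnit_iff_isUnit_det _).1 hS.isUnit
  rw [← sqrt_mul_sqrt hS.posSemidef, Matrix.det_mul] at h
  exact isUnit_of_mul_isUnit_left h

lemma sqrt_posDef {S : Matrix r r ℂ} (hS : S.PosDef) : (CFC.sqrt S).PosDef :=
  (sqrt_posSemidef S).posDef_iff_isUnit.2 ((Matrix.isUnit_iff_isUnit_det _).2 (isUnit_det_sqrt hS))

lemma one_kronecker_conj_sqrt_sqrt {S : Matrix r r ℂ} (hS : S.PosDef)
    (ρ : Matrix (a × r) (a × r) ℂ) :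
    (1 : Matrix a a ℂ) ⊗ₖ CFC.sqrt (CFC.sqrt S) *
      ((1 : Matrix a a ℂ) ⊗ₖ (CFC.sqrt (CFC.sqrt S))⁻¹ * ρ *
        (1 : Matrix a a ℂ) ⊗ₖ (CFC.sqrt (CFC.sqrt S))⁻¹) *
      (1 : Matrix a a ℂ) ⊗ₖ CFC.sqrt (CFC.sqrt S) = ρ := by
  have h := isUnit_det_sqrt (sqrt_posDef hS)
  simp only [Matrix.mul_assoc]
  rw [← Matrix.mul_kronecker_mul, Matrix.nonsing_inv_mul _ h, Matrix.one_mul,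
    Matrix.one_kronecker_one, Matrix.mul_one, ← Matrix.mul_assoc, ← Matrix.mul_kronecker_mul,
    Matrix.mul_nonsing_inv _ h, Matrix.one_mul, Matrix.one_kronecker_one, Matrix.one_mul]

lemma hsNorm_sq_eq_collision {S : Matrix r r ℂ} (hS : S.PosDef) {ρ : Matrix (a × r) (a × r) ℂ}
    (hρ : ρᴴ = ρ) :
    hsNorm ((1 : Matrix a a ℂ) ⊗ₖ (CFC.sqrt (CFC.sqrt S))⁻¹ * ρ *
      (1 : Matrix a a ℂ) ⊗ₖ (CFC.sqrt (CFC.sqrt S))⁻¹) ^ 2 = collision ρ S := by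
  set R := (CFC.sqrt (CFC.sqrt S))⁻¹ with hR
  have hRH : Rᴴ = R := by
    rw [hR, Matrix.conjTranspose_nonsing_inv, sqrt_isHermitian]
  have hRR : R * R = (CFC.sqrt S)⁻¹ := by
    rw [hR, ← Matrix.mul_inv_rev, sqrt_mul_sqrt (sqrt_posSemidef S)]
  have hK : ((1 : Matrix a a ℂ) ⊗ₖ R)ᴴ = (1 : Matrix a a ℂ) ⊗ₖ R := by
    rw [Matrix.conjTranspose_kronecker, hRH, Matrix.conjTranspose_one]
  have hKK : (1 : Matrix a a ℂ) ⊗ₖ R * (1 : Matrix a a ℂ) ⊗ₖ R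
      = (CFC.sqrt ((1 : Matrix a a ℂ) ⊗ₖ S))⁻¹ := by
    rw [sqrt_one_kronecker hS.posSemidef, Matrix.inv_kronecker, ← hRR, ← Matrix.mul_kronecker_mul,
      Matrix.one_mul, inv_one]
  rw [collision, ← hKK, hsNorm_sq_eq_trace]
  congr 1
  simp only [Matrix.conjTranspose_mul, hK, hρ, sq]
  rw [Matrix.mul_assoc, Matrix.trace_mul_comm]
  simp only [Matrix.mul_assoc]
  rw [Matrix.trace_mul_comm]
  simp only [Matrix.mul_assoc]

lemma collision_nonneg {S : Matrix r r ℂ} (hS : S.PosDef) {ρ : Matrix (a × r) (a × r) ℂ}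
    (hρ : ρᴴ = ρ) : 0 ≤ collision ρ S := by
  rw [← hsNorm_sq_eq_collision hS hρ]
  positivity

/-- The Cauchy–Schwarz inequality for averages. -/
lemma sum_mul_le_of_sum_sq_le {ι : Type*} [Fintype ι] {f h : ι → ℝ} {c x y : ℝ}
    (hf : ∑ j, f j ^ 2 ≤ c * x ^ 2) (hh : ∑ j, h j ^ 2 ≤ c * y ^ 2) (hc : 0 ≤ c) (hx : 0 ≤ x)
    (hy : 0 ≤ y) : ∑ j, f j * h j ≤ c * (x * y) := by
  refine (Real.sum_mul_le_sqrt_mul_sqrt Finset.univ f h).trans ?_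
  calc √(∑ j, f j ^ 2) * √(∑ j, h j ^ 2) ≤ √(c * x ^ 2) * √(c * y ^ 2) := by gcongr
    _ = c * (x * y) := by
      rw [← Real.sqrt_mul (by positivity), show c * x ^ 2 * (c * y ^ 2) = (c * (x * y)) ^ 2 by ring,
        Real.sqrt_sq (by positivity)]

lemma sum_traceNorm_twist_sub_left_le (A B : Matrix (i × e) κ ℂ) (C : Matrix (a × r) μ ℂ) :
    ∑ f : i × a → ZMod 3,
        traceNorm (twist (phase f) (A * Aᴴ) (C * Cᴴ) - twist (phase f) (B * Bᴴ) (C * Cᴴ))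
      ≤ Fintype.card (i × a → ZMod 3) * (hsNorm (A - B) * hsNorm (A + B) * hsNorm C ^ 2) := by
  have h1 : ∀ f : i × a → ZMod 3,
      traceNorm (twist (phase f) (A * Aᴴ) (C * Cᴴ) - twist (phase f) (B * Bᴴ) (C * Cᴴ))
        ≤ hsNorm (twistSqrt (phase f) (A - B) C) * hsNorm (twistSqrt (phase f) (A + B) C) := by
    intro f
    rw [← twistSqrt_mul_conjTranspose, ← twistSqrt_mul_conjTranspose, twistSqrt_sub_left,
      twistSqrt_add_left]
    exact traceNorm_mul_conjTranspose_sub_le _ _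
  refine (Finset.sum_le_sum fun f _ => h1 f).trans ?_
  have := sum_mul_le_of_sum_sq_le (c := Fintype.card (i × a → ZMod 3))
    (x := hsNorm (A - B) * hsNorm C) (y := hsNorm (A + B) * hsNorm C)
    ((sum_hsNorm_twistSqrt_sq (A - B) C).trans_le (by rw [mul_pow]))
    ((sum_hsNorm_twistSqrt_sq (A + B) C).trans_le (by rw [mul_pow])) (by positivity)
    (mul_nonneg (hsNorm_nonneg _) (hsNorm_nonneg _))
    (mul_nonneg (hsNorm_nonneg _) (hsNorm_nonneg _))
  refine this.trans_eq ?_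
  ring

lemma sum_traceNorm_twist_sub_right_le (A : Matrix (i × e) κ ℂ) (C D : Matrix (a × r) μ ℂ) :
    ∑ f : i × a → ZMod 3,
        traceNorm (twist (phase f) (A * Aᴴ) (C * Cᴴ) - twist (phase f) (A * Aᴴ) (D * Dᴴ))
      ≤ Fintype.card (i × a → ZMod 3) * (hsNorm A ^ 2 * (hsNorm (C - D) * hsNorm (C + D))) := by
  have h1 : ∀ f : i × a → ZMod 3,
      traceNorm (twist (phase f) (A * Aᴴ) (C * Cᴴ) - twist (phase f) (A * Aᴴ) (D * Dᴴ))
        ≤ hsNorm (twistSqrt (phase f) A (C - D)) * hsNorm (twistSqrt (phase f) A (C + D)) := by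
    intro f
    rw [← twistSqrt_mul_conjTranspose, ← twistSqrt_mul_conjTranspose, twistSqrt_sub_right,
      twistSqrt_add_right]
    exact traceNorm_mul_conjTranspose_sub_le _ _
  refine (Finset.sum_le_sum fun f _ => h1 f).trans ?_
  have := sum_mul_le_of_sum_sq_le (c := Fintype.card (i × a → ZMod 3))
    (x := hsNorm A * hsNorm (C - D)) (y := hsNorm A * hsNorm (C + D))
    ((sum_hsNorm_twistSqrt_sq A (C - D)).trans_le (by rw [mul_pow]))
    ((sum_hsNorm_twistSqrt_sq A (C + D)).trans_le (by rw [mul_pow])) (by positivity)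
    (mul_nonneg (hsNorm_nonneg _) (hsNorm_nonneg _))
    (mul_nonneg (hsNorm_nonneg _) (hsNorm_nonneg _))
  refine this.trans_eq ?_
  ring

/-- The product of the marginals is the average of `twist`, so that it moves at most as much as
`twist` does on average. -/
lemma card_mul_traceNorm_kronecker_sub_le (ω ω' : Matrix (i × e) (i × e) ℂ)
    (ρ ρ' : Matrix (a × r) (a × r) ℂ) :
    Fintype.card (i × a → ZMod 3)
        * traceNorm (traceFst ω ⊗ₖ traceFst ρ - traceFst ω' ⊗ₖ traceFst ρ')
      ≤ ∑ f : i × a → ZMod 3, traceNorm (twist (phase f) ω ρ - twist (phase f) ω' ρ') := by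
  refine le_trans (le_of_eq ?_) (traceNorm_sum_le Finset.univ _)
  rw [Finset.sum_sub_distrib, sum_twist_phase, sum_twist_phase, ← smul_sub,
    ← traceNorm_smul_of_nonneg (by positivity)]
  simp

omit [DecidableEq r] in
lemma traceFst_conj (X : Matrix (a × r) (a × r) ℂ) (u : Matrix r r ℂ) :
    traceFst ((1 : Matrix a a ℂ) ⊗ₖ u * X * (1 : Matrix a a ℂ) ⊗ₖ u) = u * traceFst X * u := by
  have : ∀ Y : Matrix (a × r) (a × r) ℂ, traceFst Y = ∑ k, block Y k k := by
    intro Y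
    ext x y
    simp [traceFst, block, Matrix.sum_apply]
  simp only [this, block_conj, Finset.mul_sum, Finset.sum_mul]

/-- Decoupling without smoothing. -/
lemma sum_traceNorm_twist_sub_le_sqrt {ω : Matrix (i × e) (i × e) ℂ}
    {ρ : Matrix (a × r) (a × r) ℂ} (hω : ωᴴ = ω) (hρ : ρᴴ = ρ) {S : Matrix e e ℂ}
    {T : Matrix r r ℂ} (hS : S.PosDef) (hT : T.PosDef) (hS1 : S.trace = 1) (hT1 : T.trace = 1) :
    ∑ f : i × a → ZMod 3, traceNorm (twist (phase f) ω ρ - traceFst ω ⊗ₖ traceFst ρ)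
      ≤ Fintype.card (i × a → ZMod 3) * √(collision ω S * collision ρ T) := by
  set s := CFC.sqrt (CFC.sqrt S) with hs
  set t := CFC.sqrt (CFC.sqrt T) with ht
  set ω' := (1 : Matrix i i ℂ) ⊗ₖ s⁻¹ * ω * (1 : Matrix i i ℂ) ⊗ₖ s⁻¹ with hω'
  set ρ' := (1 : Matrix a a ℂ) ⊗ₖ t⁻¹ * ρ * (1 : Matrix a a ℂ) ⊗ₖ t⁻¹ with hρ'
  have eω : (1 : Matrix i i ℂ) ⊗ₖ s * ω' * (1 : Matrix i i ℂ) ⊗ₖ s = ω :=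
    one_kronecker_conj_sqrt_sqrt hS ω
  have eρ : (1 : Matrix a a ℂ) ⊗ₖ t * ρ' * (1 : Matrix a a ℂ) ⊗ₖ t = ρ :=
    one_kronecker_conj_sqrt_sqrt hT ρ
  have eω' : s * traceFst ω' * s = traceFst ω := by rw [← traceFst_conj, eω]
  have eρ' : t * traceFst ρ' * t = traceFst ρ := by rw [← traceFst_conj, eρ]
  have h1 : ∀ f : i × a → ZMod 3,
      traceNorm (twist (phase f) ω ρ - traceFst ω ⊗ₖ traceFst ρ)
        ≤ 1 * hsNorm (twist (phase f) ω' ρ' - traceFst ω' ⊗ₖ traceFst ρ') := by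
    intro f
    have h2 : twist (phase f) ω ρ - traceFst ω ⊗ₖ traceFst ρ
        = (s ⊗ₖ t) * (twist (phase f) ω' ρ' - traceFst ω' ⊗ₖ traceFst ρ') * (s ⊗ₖ t) := by
      rw [Matrix.mul_sub, Matrix.sub_mul, ← twist_conj, eω, eρ, ← Matrix.mul_kronecker_mul,
        ← Matrix.mul_kronecker_mul, eω', eρ']
    have h3 : hsNorm (s ⊗ₖ t * s ⊗ₖ t) = 1 := by
      rw [← sq_eq_sq₀ (hsNorm_nonneg _) zero_le_one, ← Matrix.mul_kronecker_mul, hs, ht,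
        sqrt_mul_sqrt (sqrt_posSemidef S), sqrt_mul_sqrt (sqrt_posSemidef T), hsNorm_sq_eq_trace,
        Matrix.conjTranspose_kronecker, sqrt_isHermitian, sqrt_isHermitian,
        ← Matrix.mul_kronecker_mul, sqrt_mul_sqrt hS.posSemidef, sqrt_mul_sqrt hT.posSemidef,
        Matrix.trace_kronecker, hS1, hT1]
      simp
    rw [h2, ← h3]
    refine traceNorm_mul_mul_le ?_ _
    rw [Matrix.conjTranspose_kronecker, hs, ht, sqrt_isHermitian, sqrt_isHermitian]
  refine (Finset.sum_le_sum fun f _ => h1 f).trans ?_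
  refine (sum_mul_le_of_sum_sq_le (c := Fintype.card (i × a → ZMod 3)) (x := 1)
    (y := hsNorm ω' * hsNorm ρ') (by simp) ?_ (by positivity) zero_le_one
    (mul_nonneg (hsNorm_nonneg _) (hsNorm_nonneg _))).trans_eq ?_
  · rw [mul_pow]
    exact sum_hsNorm_twist_sub_sq_le ω' ρ'
  · rw [one_mul, ← hsNorm_sq_eq_collision hS hω, ← hsNorm_sq_eq_collision hT hρ, ← mul_pow,
      Real.sqrt_sq (mul_nonneg (hsNorm_nonneg _) (hsNorm_nonneg _))]

/-- The decoupling inequality: on average over the random phases, `twist` is close to the product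
of the marginals. The operators `B B†` and `D D†` are the smoothed versions of `A A†` and
`C C†`. -/
lemma sum_traceNorm_twist_sub_le {A B : Matrix (i × e) κ ℂ} {C D : Matrix (a × r) μ ℂ} {ε : ℝ}
    (hAB : hsNorm (A - B) * hsNorm (A + B) ≤ 2 * ε) (hCD : hsNorm (C - D) * hsNorm (C + D) ≤ 2 * ε)
    (hB : hsNorm B ^ 2 ≤ 1) (hC : hsNorm C ^ 2 ≤ 1) {S : Matrix e e ℂ} {T : Matrix r r ℂ}
    (hS : S.PosDef) (hT : T.PosDef) (hS1 : S.trace = 1) (hT1 : T.trace = 1) :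
    ∑ f : i × a → ZMod 3, traceNorm (twist (phase f) (A * Aᴴ) (C * Cᴴ)
        - traceFst (A * Aᴴ) ⊗ₖ traceFst (C * Cᴴ))
      ≤ Fintype.card (i × a → ZMod 3)
        * (√(collision (B * Bᴴ) S * collision (D * Dᴴ) T) + 8 * ε) := by
  have hε : 0 ≤ 2 * ε := (mul_nonneg (hsNorm_nonneg _) (hsNorm_nonneg _)).trans hAB
  set c : ℝ := (Fintype.card (i × a → ZMod 3) : ℝ) with hc
  have hc0 : 0 ≤ c := by positivity
  have h1 : ∑ f : i × a → ZMod 3,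
      traceNorm (twist (phase f) (A * Aᴴ) (C * Cᴴ) - twist (phase f) (B * Bᴴ) (C * Cᴴ))
        ≤ c * (2 * ε) := by
    refine (sum_traceNorm_twist_sub_left_le A B C).trans ?_
    refine mul_le_mul_of_nonneg_left ?_ hc0
    nlinarith [sq_nonneg (hsNorm C)]
  have h2 : ∑ f : i × a → ZMod 3,
      traceNorm (twist (phase f) (B * Bᴴ) (C * Cᴴ) - twist (phase f) (B * Bᴴ) (D * Dᴴ))
        ≤ c * (2 * ε) := by
    refine (sum_traceNorm_twist_sub_right_le B C D).trans ?_
    refine mul_le_mul_of_nonneg_left ?_ hc0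
    nlinarith [sq_nonneg (hsNorm B)]
  have h3 : ∑ f : i × a → ZMod 3,
      traceNorm (twist (phase f) (A * Aᴴ) (C * Cᴴ) - twist (phase f) (B * Bᴴ) (D * Dᴴ))
        ≤ c * (4 * ε) := by
    refine (Finset.sum_le_sum fun f _ => traceNorm_sub_le _
      (twist (phase f) (B * Bᴴ) (C * Cᴴ)) _).trans ?_
    rw [Finset.sum_add_distrib]
    linarith
  have h4 : ∑ _f : i × a → ZMod 3, traceNorm (traceFst (A * Aᴴ) ⊗ₖ traceFst (C * Cᴴ)
      - traceFst (B * Bᴴ) ⊗ₖ traceFst (D * Dᴴ)) ≤ c * (4 * ε) := by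
    rw [Finset.sum_const, Finset.card_univ, nsmul_eq_mul]
    exact (card_mul_traceNorm_kronecker_sub_le _ _ _ _).trans h3
  have h5 := sum_traceNorm_twist_sub_le_sqrt (i := i) (a := a)
    (Matrix.posSemidef_self_mul_conjTranspose B).isHermitian.eq
    (Matrix.posSemidef_self_mul_conjTranspose D).isHermitian.eq hS hT hS1 hT1
  have h6 : ∀ f : i × a → ZMod 3, traceNorm (twist (phase f) (A * Aᴴ) (C * Cᴴ)
        - traceFst (A * Aᴴ) ⊗ₖ traceFst (C * Cᴴ))
      ≤ traceNorm (twist (phase f) (A * Aᴴ) (C * Cᴴ) - twist (phase f) (B * Bᴴ) (D * Dᴴ))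
        + (traceNorm (twist (phase f) (B * Bᴴ) (D * Dᴴ)
            - traceFst (B * Bᴴ) ⊗ₖ traceFst (D * Dᴴ))
          + traceNorm (traceFst (A * Aᴴ) ⊗ₖ traceFst (C * Cᴴ)
            - traceFst (B * Bᴴ) ⊗ₖ traceFst (D * Dᴴ))) := by
    intro f
    rw [traceNorm_sub_comm (traceFst (A * Aᴴ) ⊗ₖ traceFst (C * Cᴴ))]
    exact (traceNorm_sub_le _ (twist (phase f) (B * Bᴴ) (D * Dᴴ)) _).trans
      (add_le_add_right (traceNorm_sub_le _ _ _) _)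
  refine (Finset.sum_le_sum fun f _ => h6 f).trans ?_
  rw [Finset.sum_add_distrib, Finset.sum_add_distrib]
  linarith

end Average

/-! ### Smoothing -/

section Smoothing

variable {a c m n : Type*} [Fintype a] [Fintype c] [Fintype m] [Fintype n] [DecidableEq a]
  [DecidableEq c] [DecidableEq n]

omit [DecidableEq n] in
lemma hsNorm_sub_mul_hsNorm_add_le {A B : Matrix m n ℂ} {ε F : ℝ} (hε : 0 ≤ ε)
    (hA : hsNorm A ^ 2 ≤ 1) (hB : hsNorm B ^ 2 ≤ 1) (hF0 : 0 ≤ F) (hF : F ≤ (Aᴴ * B).trace.re)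
    (hFε : 1 - F ^ 2 ≤ ε ^ 2) : hsNorm (A - B) * hsNorm (A + B) ≤ 2 * ε := by
  rw [← sq_le_sq₀ (mul_nonneg (hsNorm_nonneg _) (hsNorm_nonneg _)) (by positivity), mul_pow,
    hsNorm_sub_sq, hsNorm_add_sq]
  set G := (Aᴴ * B).trace.re
  have h1 : F ^ 2 ≤ G ^ 2 := by gcongr
  have h2 : (hsNorm A ^ 2 + hsNorm B ^ 2) ^ 2 ≤ 2 ^ 2 := by
    gcongr
    linarith
  nlinarith

lemma fidelityDist_le_iff {ρ τ : Matrix n n ℂ} {ε : ℝ} (hε : 0 ≤ ε) :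
    fidelityDist ρ τ ≤ ε ↔ 1 - fidelity ρ τ ^ 2 ≤ ε ^ 2 :=
  Real.sqrt_le_left hε

omit [DecidableEq n] in
lemma hsNorm_sq_of_mul_conjTranspose {A : Matrix m n ℂ} {X : Matrix m m ℂ} (h : A * Aᴴ = X) :
    hsNorm A ^ 2 = X.trace.re := by
  rw [hsNorm_sq_eq_trace', h]

/-- Operators at small fidelity distance have purifications that are close in Hilbert–Schmidt
norm. -/
lemma exists_factor_of_mem_smoothBall {ρ τ : Matrix n n ℂ} {ε : ℝ} (hε : 0 ≤ ε)
    (hρ : ρ.PosSemidef) (hρ1 : ρ.trace.re ≤ 1) (hτ : τ ∈ smoothBall ρ ε) :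
    ∃ A B : Matrix n (n ⊕ n) ℂ, A * Aᴴ = ρ ∧ B * Bᴴ = τ ∧
      hsNorm (A - B) * hsNorm (A + B) ≤ 2 * ε := by
  obtain ⟨hτ0, hτ1, hd⟩ := hτ
  obtain ⟨V, hV, hV1, -⟩ := exists_polar (CFC.sqrt ρ * CFC.sqrt τ)
  -- the second block completes the partial isometry `V` to a co-isometry
  set A := Matrix.fromCols (CFC.sqrt ρ * V) (CFC.sqrt ρ * (1 - V * Vᴴ)) with hA
  set B := Matrix.fromCols (CFC.sqrt τ) (0 : Matrix n n ℂ) with hB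
  have hAA : A * Aᴴ = ρ := by
    have hc : V * Vᴴ + (1 - V * Vᴴ) * (1 - V * Vᴴ) = 1 := by
      have := hV.2.eq
      simp only [Matrix.sub_mul, Matrix.mul_sub, Matrix.one_mul, Matrix.mul_one, this]
      abel
    have e : A * Aᴴ = CFC.sqrt ρ * (V * Vᴴ + (1 - V * Vᴴ) * (1 - V * Vᴴ)) * CFC.sqrt ρ := by
      rw [hA, Matrix.conjTranspose_fromCols_eq_fromRows_conjTranspose, Matrix.fromCols_mul_fromRows]
      simp only [Matrix.conjTranspose_mul, sqrt_isHermitian, Matrix.conjTranspose_sub,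
        Matrix.conjTranspose_one, Matrix.conjTranspose_conjTranspose, Matrix.mul_add,
        Matrix.add_mul, Matrix.mul_assoc]
    rw [e, hc, Matrix.mul_one, sqrt_mul_sqrt hρ]
  have hBB : B * Bᴴ = τ := by
    rw [hB, Matrix.conjTranspose_fromCols_eq_fromRows_conjTranspose, Matrix.fromCols_mul_fromRows,
      sqrt_isHermitian, sqrt_mul_sqrt hτ0]
    simp
  refine ⟨A, B, hAA, hBB, ?_⟩
  have hF : (Aᴴ * B).trace.re = fidelity ρ τ := by
    have : (B * Aᴴ).trace = (Vᴴ * (CFC.sqrt ρ * CFC.sqrt τ)).trace := by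
      rw [hA, hB, Matrix.conjTranspose_fromCols_eq_fromRows_conjTranspose,
        Matrix.fromCols_mul_fromRows, Matrix.zero_mul, add_zero, Matrix.conjTranspose_mul,
        sqrt_isHermitian, Matrix.trace_mul_comm, Matrix.mul_assoc]
    rw [Matrix.trace_mul_comm, this, hV1]
    rfl
  refine hsNorm_sub_mul_hsNorm_add_le hε ?_ ?_ (traceNorm_nonneg _) hF.ge
    ((fidelityDist_le_iff hε).1 hd)
  · rwa [hsNorm_sq_of_mul_conjTranspose hAA]
  · rwa [hsNorm_sq_of_mul_conjTranspose hBB]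

/-- A bipartite pure state, given as the matrix of its coefficients, as a column. -/
def toColumn (Ψ : Matrix (a × Unit) c ℂ) : Matrix (a × c) Unit ℂ := fun x _ => Ψ (x.1, ()) x.2

omit [DecidableEq a] [DecidableEq c] in
lemma trace_toColumn (Φ Ψ : Matrix (a × Unit) c ℂ) :
    ((toColumn Φ)ᴴ * toColumn Ψ).trace = (Φᴴ * Ψ).trace := by
  simp [Matrix.trace, Matrix.mul_apply, toColumn, Fintype.sum_prod_type]
  rw [Finset.sum_comm]

omit [Fintype c] [DecidableEq c] [DecidableEq n] in
lemma toColumn_mul (M : Matrix (a × Unit) n ℂ) (W : Matrix n c ℂ) :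
    toColumn (M * W) = (1 : Matrix a a ℂ) ⊗ₖ Wᵀ * toColumn M := by
  ext x y
  simp [Matrix.mul_apply, toColumn, Fintype.sum_prod_type, Matrix.one_apply, mul_comm]

lemma traceMid_purify (τ : Matrix (a × Unit) (a × Unit) ℂ) :
    traceMid (Hmax.assoc' (ketbra (purify τ)))
      = toColumn (CFC.sqrt τ) * (toColumn (CFC.sqrt τ))ᴴ := by
  ext x y
  simp [Matrix.mul_apply, toColumn, traceMid, Hmax.assoc', ketbra, purify, Matrix.vecMulVec_apply]

/-- Let `Ψ` be a purification of `ρ`, and let `τ` be close to `ρ`. If `σ` witnesses a lower bound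
on the min-entropy of the canonical purification of `τ`, then this purification is taken by a
partial isometry on the purifying system to a vector `D` close to `Ψ`, and `D D†` satisfies the
same lower bound. -/
lemma exists_column_of_mem_smoothBall {Ψ : Matrix (a × Unit) c ℂ} {τ : Matrix (a × Unit) (a × Unit) ℂ}
    {ε : ℝ} (hε : 0 ≤ ε) (hΨ : hsNorm Ψ ^ 2 ≤ 1) (hτ : τ ∈ smoothBall (Ψ * Ψᴴ) ε)
    {σ : Matrix (a × Unit) (a × Unit) ℂ} (hσ : σ.PosSemidef)
    (hle : traceMid (Hmax.assoc' (ketbra (purify τ))) ≤ (1 : Matrix a a ℂ) ⊗ₖ σ) :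
    ∃ (D : Matrix (a × c) Unit ℂ) (σ' : Matrix c c ℂ),
      hsNorm (toColumn Ψ - D) * hsNorm (toColumn Ψ + D) ≤ 2 * ε ∧ hsNorm D ^ 2 ≤ 1 ∧
      σ'.PosSemidef ∧ D * Dᴴ ≤ (1 : Matrix a a ℂ) ⊗ₖ σ' ∧ σ'.trace.re ≤ σ.trace.re := by
  obtain ⟨hτ0, hτ1, hd⟩ := hτ
  obtain ⟨W, hW, hW1, -⟩ := exists_polar (CFC.sqrt τ * Ψ)
  obtain ⟨V₁, hV₁, h₁, h₁'⟩ := exists_polar Ψᴴ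
  rw [Matrix.conjTranspose_conjTranspose] at h₁ h₁'
  obtain ⟨V₂, hV₂, h₂, -⟩ := exists_polar (CFC.sqrt (Ψ * Ψᴴ) * CFC.sqrt τ)
  -- the overlap of `Ψ` and `√τ W` is at least the fidelity
  have hF : fidelity (Ψ * Ψᴴ) τ ≤ (Ψᴴ * (CFC.sqrt τ * W)).trace.re := by
    have hK := trace_mul_re_le_trace_sqrt (CFC.sqrt τ * Ψ) (V₁ * V₂) fun M => by
      rw [Matrix.mul_assoc]
      exact (hsNorm_mul_le_of_isPartialIsometry hV₁ _).trans
        (hsNorm_mul_le_of_isPartialIsometry hV₂ _)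
    have e1 : (V₁ * V₂ * (CFC.sqrt τ * Ψ)).trace.re = fidelity (Ψ * Ψᴴ) τ := by
      have e : Ψ * V₁ = CFC.sqrt (Ψ * Ψᴴ) := by
        have := congrArg Matrix.conjTranspose h₁
        rwa [Matrix.conjTranspose_mul, Matrix.conjTranspose_conjTranspose,
          Matrix.conjTranspose_conjTranspose, sqrt_isHermitian] at this
      have e' : (V₁ * V₂ * (CFC.sqrt τ * Ψ)).trace
          = (V₂ᴴ * (CFC.sqrt (Ψ * Ψᴴ) * CFC.sqrt τ))ᴴ.trace := by
        rw [Matrix.mul_assoc, Matrix.trace_mul_comm, Matrix.mul_assoc, Matrix.mul_assoc, e]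
        simp only [Matrix.conjTranspose_mul, sqrt_isHermitian, Matrix.conjTranspose_conjTranspose]
        rw [Matrix.trace_mul_comm]
      rw [e', h₂, sqrt_isHermitian]
      rfl
    have e2 : (Ψᴴ * (CFC.sqrt τ * W)).trace.re = (Wᴴ * (CFC.sqrt τ * Ψ)).trace.re := by
      have : Ψᴴ * (CFC.sqrt τ * W) = (Wᴴ * (CFC.sqrt τ * Ψ))ᴴ := by
        simp only [Matrix.conjTranspose_mul, sqrt_isHermitian, Matrix.conjTranspose_conjTranspose,
          Matrix.mul_assoc]
      rw [this, Matrix.trace_conjTranspose]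
      simp
    rw [e2, hW1, ← e1]
    exact hK
  have hD1 : hsNorm (toColumn (CFC.sqrt τ * W)) ^ 2 ≤ 1 := by
    rw [hsNorm_sq_eq_trace, trace_toColumn, ← hsNorm_sq_eq_trace]
    calc hsNorm (CFC.sqrt τ * W) ^ 2 ≤ hsNorm (CFC.sqrt τ) ^ 2 := by
          gcongr
          · exact hsNorm_nonneg _
          · exact hsNorm_mul_le_of_isPartialIsometry_right hW _
      _ ≤ 1 := by
          rwa [hsNorm_sq_eq_trace', sqrt_isHermitian, sqrt_mul_sqrt hτ0]
  refine ⟨toColumn (CFC.sqrt τ * W), Wᵀ * σ * Wᵀᴴ, ?_, hD1, hσ.mul_mul_conjTranspose_same _, ?_, ?_⟩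
  · refine hsNorm_sub_mul_hsNorm_add_le hε ?_ hD1 (traceNorm_nonneg _) ?_
      ((fidelityDist_le_iff hε).1 hd)
    · rwa [hsNorm_sq_eq_trace, trace_toColumn, ← hsNorm_sq_eq_trace]
    · rw [trace_toColumn]
      exact hF
  · have e1 : toColumn (CFC.sqrt τ * W) * (toColumn (CFC.sqrt τ * W))ᴴ
        = (1 : Matrix a a ℂ) ⊗ₖ Wᵀ * traceMid (Hmax.assoc' (ketbra (purify τ)))
          * ((1 : Matrix a a ℂ) ⊗ₖ Wᵀ)ᴴ := by
      rw [traceMid_purify, toColumn_mul, Matrix.conjTranspose_mul]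
      simp only [Matrix.mul_assoc]
    have e2 : (1 : Matrix a a ℂ) ⊗ₖ (Wᵀ * σ * Wᵀᴴ)
        = (1 : Matrix a a ℂ) ⊗ₖ Wᵀ * ((1 : Matrix a a ℂ) ⊗ₖ σ) * ((1 : Matrix a a ℂ) ⊗ₖ Wᵀ)ᴴ := by
      rw [Matrix.conjTranspose_kronecker, ← Matrix.mul_kronecker_mul, ← Matrix.mul_kronecker_mul,
        Matrix.conjTranspose_one, Matrix.one_mul, Matrix.one_mul]
    rw [e1, e2, Matrix.le_iff, ← Matrix.sub_mul, ← Matrix.mul_sub]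
    exact (Matrix.le_iff.1 hle).mul_mul_conjTranspose_same _
  · have h := trace_mul_re_nonneg hW.transpose.posSemidef_one_sub hσ
    rw [Matrix.sub_mul, Matrix.one_mul, Matrix.trace_sub, Complex.sub_re, Matrix.mul_assoc,
      Matrix.trace_mul_comm, Matrix.trace_mul_comm] at h
    rw [Matrix.trace_mul_comm]
    rw [Matrix.trace_mul_comm Wᵀᴴ] at h ⊢
    linarith

/-- The conditional 2-entropy dominates the conditional min-entropy. -/
lemma exists_collision_lt [Nonempty c] {ρ : Matrix (a × c) (a × c) ℂ} (hρ : ρ.PosSemidef)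
    (hρ1 : ρ.trace.re ≤ 1) {σ : Matrix c c ℂ} (hσ : σ.PosSemidef)
    (hle : ρ ≤ (1 : Matrix a a ℂ) ⊗ₖ σ) {v : ℝ} (hv : σ.trace.re < v) :
    ∃ S : Matrix c c ℂ, S.PosDef ∧ S.trace = 1 ∧ collision ρ S ≤ v := by
  have hσ0 : 0 ≤ σ.trace.re := (Complex.le_def.1 hσ.trace_nonneg).1
  have hσre : ((σ.trace.re : ℝ) : ℂ) = σ.trace := by
    refine Complex.ext rfl ?_
    simpa using (Complex.le_def.1 hσ.trace_nonneg).2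
  have hv0 : 0 < v := hσ0.trans_lt hv
  set t := (v - σ.trace.re) / Fintype.card c with ht
  have hcard : (0 : ℝ) < Fintype.card c := by exact_mod_cast Fintype.card_pos
  have ht0 : 0 < t := div_pos (by linarith) hcard
  set σt := σ + (t : ℂ) • (1 : Matrix c c ℂ) with hσt
  have ht0' : (0 : ℂ) < (t : ℂ) := by exact_mod_cast ht0
  have hv0' : (0 : ℂ) < (v : ℂ) := by exact_mod_cast hv0
  have hvne : (v : ℂ) ≠ 0 := by exact_mod_cast hv0.ne'
  have hσtd : σt.PosDef := Matrix.PosDef.posSemidef_add hσ (Matrix.PosDef.one.smul ht0')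
  have hσttr : σt.trace = v := by
    rw [hσt, Matrix.trace_add, Matrix.trace_smul, Matrix.trace_one, ← hσre, smul_eq_mul, ht]
    have : (Fintype.card c : ℂ) ≠ 0 := by exact_mod_cast hcard.ne'
    push_cast
    field_simp
    ring
  have hS : ((v : ℂ)⁻¹ • σt).PosDef := hσtd.smul (by
    rw [← Complex.ofReal_inv]; exact_mod_cast inv_pos.2 hv0)
  refine ⟨(v : ℂ)⁻¹ • σt, hS, ?_, ?_⟩
  · rw [Matrix.trace_smul, hσttr, smul_eq_mul, inv_mul_cancel₀ hvne]
  set S := (v : ℂ)⁻¹ • σt with hSdef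
  have hσS : σt = (v : ℂ) • S := by rw [hSdef, smul_smul, mul_inv_cancel₀ hvne, one_smul]
  have hle' : ((1 : Matrix a a ℂ) ⊗ₖ σt - ρ).PosSemidef := by
    have : (1 : Matrix a a ℂ) ⊗ₖ σt - ρ = ((1 : Matrix a a ℂ) ⊗ₖ σ - ρ)
        + (t : ℂ) • (1 : Matrix (a × c) (a × c) ℂ) := by
      rw [hσt, Matrix.kronecker_add, Matrix.kronecker_smul, Matrix.one_kronecker_one]
      abel
    rw [this]
    exact (Matrix.le_iff.1 hle).add (Matrix.PosSemidef.one.smul ht0'.le)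
  have h1S : ((1 : Matrix a a ℂ) ⊗ₖ S).PosDef := Matrix.PosDef.one.kronecker hS
  set Z := CFC.sqrt ((1 : Matrix a a ℂ) ⊗ₖ S) with hZ
  have hZu : IsUnit Z.det := isUnit_det_sqrt h1S
  have hZH : (Z⁻¹)ᴴ = Z⁻¹ := by rw [Matrix.conjTranspose_nonsing_inv, hZ, sqrt_isHermitian]
  have hM : (Z⁻¹ * ρ * Z⁻¹).PosSemidef := by
    have := hρ.mul_mul_conjTranspose_same Z⁻¹
    rwa [hZH] at this
  have h1 := trace_mul_re_nonneg hM hle'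
  have h2 : (Z⁻¹ * ρ * Z⁻¹ * ((1 : Matrix a a ℂ) ⊗ₖ σt)).trace = v * ρ.trace := by
    rw [hσS, Matrix.kronecker_smul, Matrix.mul_smul, Matrix.trace_smul, smul_eq_mul,
      ← sqrt_mul_sqrt h1S.posSemidef, ← hZ, ← Matrix.mul_assoc, Matrix.mul_assoc (Z⁻¹ * ρ),
      Matrix.nonsing_inv_mul _ hZu, Matrix.mul_one, Matrix.trace_mul_comm, ← Matrix.mul_assoc,
      Matrix.mul_nonsing_inv _ hZu, Matrix.one_mul]
  have h3 : collision ρ S = (Z⁻¹ * ρ * Z⁻¹ * ρ).trace.re := by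
    rw [collision, sq, ← hZ]
    simp only [Matrix.mul_assoc]
  rw [Matrix.mul_sub, Matrix.trace_sub, h2, Complex.sub_re, ← h3, Complex.re_ofReal_mul] at h1
  nlinarith

end Smoothing

/-! ### Entropies -/

section Logarithm

lemma log_two_pos' : (0 : EReal) < (Real.log 2 : ℝ) := by
  exact_mod_cast Real.log_pos one_lt_two

lemma pow2_log2 (x : ℝ≥0∞) : pow2 (log2 x) = x := by
  rw [pow2, log2, EReal.div_mul_cancel (EReal.coe_ne_bot _) (EReal.coe_ne_top _)
    log_two_pos'.ne', ENNReal.exp_log]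

lemma log2_pow2 (x : EReal) : log2 (pow2 x) = x := by
  rw [pow2, log2, EReal.log_exp, ← EReal.mul_div, EReal.div_self (EReal.coe_ne_bot _)
    (EReal.coe_ne_top _) log_two_pos'.ne', mul_one]

lemma log2_mono : Monotone log2 := fun _ _ h =>
  EReal.div_le_div_right_of_nonneg log_two_pos'.le (ENNReal.log_monotone h)

lemma pow2_mono : Monotone pow2 := fun _ _ h =>
  EReal.exp_monotone (mul_le_mul_of_nonneg_right h log_two_pos'.le)

/-- The base-2 logarithm as an order isomorphism. -/
def log2OrderIso : ℝ≥0∞ ≃o EReal where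
  toFun := log2
  invFun := pow2
  left_inv := pow2_log2
  right_inv := log2_pow2
  map_rel_iff' {x y} := ⟨fun h => by
    have := pow2_mono h
    rwa [Equiv.coe_fn_mk, pow2_log2, pow2_log2] at this, fun h => log2_mono h⟩

lemma log2_iInf {ι : Sort*} (f : ι → ℝ≥0∞) : log2 (⨅ j, f j) = ⨅ j, log2 (f j) :=
  log2OrderIso.map_iInf f

lemma neg_iInf_eq {ι : Sort*} (f : ι → EReal) : -⨅ j, f j = ⨆ j, -f j :=
  EReal.negOrderIso.map_iInf f

lemma pow2_half_add (x y : ℝ≥0∞) :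
    pow2 (((1 / 2 : ℝ) : EReal) * log2 x + ((1 / 2 : ℝ) : EReal) * log2 y)
      = (x * y) ^ (1 / 2 : ℝ) := by
  have key : ∀ z : ℝ≥0∞, EReal.exp (((1 / 2 : ℝ) : EReal) * log2 z * (Real.log 2 : ℝ))
      = z ^ (1 / 2 : ℝ) := by
    intro z
    rw [mul_assoc, mul_comm, EReal.exp_mul]
    congr 1
    exact pow2_log2 z
  rw [pow2, EReal.right_distrib_of_nonneg_of_ne_top log_two_pos'.le (EReal.coe_ne_top _),
    EReal.exp_add, key, key, ENNReal.mul_rpow_of_nonneg _ _ (by norm_num)]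

end Logarithm

section Entropy

variable {a c n : Type*} [Fintype a] [Fintype c] [Fintype n] [DecidableEq a] [DecidableEq c]
  [DecidableEq n]

/-- `2^{-H₂^ε(A|B)}`. -/
def collisionInf (ε : ℝ) (ρ : Matrix (a × c) (a × c) ℂ) : ℝ≥0∞ :=
  ⨅ τ ∈ smoothBall ρ ε, ⨅ (S : Matrix c c ℂ) (_ : S.PosDef ∧ S.trace = 1),
    ENNReal.ofReal (collision τ S)

/-- `2^{H_max^ε(A|B)}`. -/
def maxInf (ε : ℝ) (ρ : Matrix (a × c) (a × c) ℂ) : ℝ≥0∞ :=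
  ⨅ τ ∈ smoothBall ρ ε, ⨅ (σ : Matrix (a × c) (a × c) ℂ) (_ : σ.PosSemidef ∧
    traceMid (Hmax.assoc' (ketbra (purify τ))) ≤ (1 : Matrix a a ℂ) ⊗ₖ σ),
    ENNReal.ofReal σ.trace.re

lemma H2smooth_eq (ε : ℝ) (ρ : Matrix (a × c) (a × c) ℂ) :
    H2smooth ε ρ = -log2 (collisionInf ε ρ) := by
  simp only [H2smooth, H2, collisionInf, log2_iInf, neg_iInf_eq]
  rfl

lemma Hmaxsmooth_eq (ε : ℝ) (ρ : Matrix (a × c) (a × c) ℂ) :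
    Hmaxsmooth ε ρ = log2 (maxInf ε ρ) := by
  simp only [Hmaxsmooth, Hmax, Hmin, maxInf, log2_iInf, neg_neg]

lemma pow2_Hmaxsmooth_sub (ε : ℝ) {b d : Type*} [Fintype b] [Fintype d] [DecidableEq b]
    [DecidableEq d] (ρ : Matrix (a × c) (a × c) ℂ) (ω : Matrix (b × d) (b × d) ℂ) :
    pow2 (((1 / 2 : ℝ) : EReal) * Hmaxsmooth ε ρ - ((1 / 2 : ℝ) : EReal) * H2smooth ε ω)
      = (maxInf ε ρ * collisionInf ε ω) ^ (1 / 2 : ℝ) := by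
  rw [Hmaxsmooth_eq, H2smooth_eq, mul_neg, sub_eq_add_neg, neg_neg, pow2_half_add]

lemma pow2_neg_H2smooth_sub (ε : ℝ) {b d : Type*} [Fintype b] [Fintype d] [DecidableEq b]
    [DecidableEq d] (ρ : Matrix (a × c) (a × c) ℂ) (ω : Matrix (b × d) (b × d) ℂ) :
    pow2 (-(((1 / 2 : ℝ) : EReal) * H2smooth ε ρ) - ((1 / 2 : ℝ) : EReal) * H2smooth ε ω)
      = (collisionInf ε ρ * collisionInf ε ω) ^ (1 / 2 : ℝ) := by
  rw [H2smooth_eq, H2smooth_eq, mul_neg, mul_neg, sub_eq_add_neg, neg_neg, neg_neg,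
    pow2_half_add]

lemma self_mem_smoothBall {ρ : Matrix n n ℂ} (hρ : ρ.PosSemidef) (hρ1 : ρ.trace.re = 1) {ε : ℝ}
    (hε : 0 ≤ ε) : ρ ∈ smoothBall ρ ε := by
  refine ⟨hρ, hρ1.le, ?_⟩
  rw [fidelityDist_le_iff hε, fidelity, sqrt_mul_sqrt hρ, traceNorm_of_posSemidef hρ, hρ1]
  nlinarith

omit [DecidableEq n] in
lemma nonempty_of_trace_re_eq_one {ρ : Matrix n n ℂ} (h : ρ.trace.re = 1) : Nonempty n := by
  by_contra hn
  rw [not_nonempty_iff] at hn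
  simp [Matrix.trace] at h

/-- The maximally mixed state. -/
lemma exists_posDef_trace_eq_one [Nonempty n] : ∃ S : Matrix n n ℂ, S.PosDef ∧ S.trace = 1 := by
  have h : (0 : ℝ) < (Fintype.card n : ℝ)⁻¹ := by
    have : (0 : ℝ) < Fintype.card n := by exact_mod_cast Fintype.card_pos
    positivity
  refine ⟨((Fintype.card n : ℝ)⁻¹ : ℂ) • 1, Matrix.PosDef.one.smul (by exact_mod_cast h), ?_⟩
  rw [Matrix.trace_smul, Matrix.trace_one, smul_eq_mul]
  have : (Fintype.card n : ℂ) ≠ 0 := by exact_mod_cast Fintype.card_ne_zero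
  push_cast
  exact inv_mul_cancel₀ this

lemma posSemidef_trace_smul_one_sub {ρ : Matrix n n ℂ} (hρ : ρ.PosSemidef) :
    (ρ.trace • (1 : Matrix n n ℂ) - ρ).PosSemidef := by
  have hsa : IsSelfAdjoint ρ := hρ.isHermitian
  set s := ∑ j, hρ.isHermitian.eigenvalues j with hs
  have htr : ρ.trace • (1 : Matrix n n ℂ) = cfc (fun _ : ℝ => s) ρ := by
    rw [cfc_const s ρ, hρ.isHermitian.trace_eq_sum_eigenvalues, hs, Algebra.algebraMap_eq_smul_one]
    ext x y
    simp [Matrix.smul_apply]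
  have hid : ρ = cfc (fun x : ℝ => x) ρ := (cfc_id' ℝ ρ).symm
  have : ρ.trace • (1 : Matrix n n ℂ) - ρ = cfc (fun x : ℝ => s - x) ρ := by
    rw [cfc_sub _ _ ρ (continuousOn_spectrum _ _) (continuousOn_spectrum _ _), ← htr, ← hid]
  rw [this, ← Matrix.nonneg_iff_posSemidef]
  refine cfc_nonneg fun x hx => ?_
  rw [hρ.isHermitian.spectrum_real_eq_range_eigenvalues] at hx
  obtain ⟨j, rfl⟩ := hx
  exact sub_nonneg.2 (Finset.single_le_sum (fun k _ => hρ.eigenvalues_nonneg k) (Finset.mem_univ j))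

lemma collisionInf_ne_top {ρ : Matrix (a × c) (a × c) ℂ} (hρ : ρ.PosSemidef)
    (hρ1 : ρ.trace.re = 1) {ε : ℝ} (hε : 0 ≤ ε) : collisionInf ε ρ ≠ ⊤ := by
  have hn : Nonempty c := (nonempty_of_trace_re_eq_one hρ1).map Prod.snd
  obtain ⟨S, hS⟩ := exists_posDef_trace_eq_one (n := c)
  exact ne_top_of_le_ne_top ENNReal.ofReal_ne_top
    ((iInf₂_le ρ (self_mem_smoothBall hρ hρ1 hε)).trans (iInf₂_le S hS))

lemma maxInf_ne_top {ρ : Matrix (a × Unit) (a × Unit) ℂ} (hρ : ρ.PosSemidef)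
    (hρ1 : ρ.trace.re = 1) {ε : ℝ} (hε : 0 ≤ ε) : maxInf ε ρ ≠ ⊤ := by
  have h : (traceMid (Hmax.assoc' (ketbra (purify ρ)))).PosSemidef := by
    rw [traceMid_purify]
    exact Matrix.posSemidef_self_mul_conjTranspose _
  refine ne_top_of_le_ne_top ENNReal.ofReal_ne_top
    ((iInf₂_le ρ (self_mem_smoothBall hρ hρ1 hε)).trans
      (iInf₂_le ((traceMid (Hmax.assoc' (ketbra (purify ρ)))).trace • 1)
        ⟨Matrix.PosSemidef.one.smul h.trace_nonneg, ?_⟩))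
  rw [Matrix.le_iff, Matrix.kronecker_smul, Matrix.one_kronecker_one]
  exact posSemidef_trace_smul_one_sub h

/-- Since the ball has positive radius, suprema and infima over it can be replaced by values at
suitable points, at the cost of a multiple of `ε`. -/
lemma exists_approx_mul {x y : ℝ≥0∞} (hx : x ≠ ⊤) (hy : y ≠ ⊤) {ε : ℝ} (hε : 0 < ε) :
    ∃ u v : ℝ, x < ENNReal.ofReal u ∧ y < ENNReal.ofReal v ∧ 0 < u ∧ 0 < v ∧
      ENNReal.ofReal (10 / 7 * (2 * (√(u * v) + 8 * ε)))
        ≤ 3 * (x * y) ^ (1 / 2 : ℝ) + 24 * ENNReal.ofReal ε := by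
  lift x to NNReal using hx
  lift y to NNReal using hy
  set t : ℝ := min 1 ((ε / 4) ^ 2 / (x + y + 1)) with ht
  have hxy : (0 : ℝ) < x + y + 1 := by positivity
  have ht0 : 0 < t := lt_min one_pos (by positivity)
  have ht1 : t ≤ 1 := min_le_left _ _
  have ht2 : t * (x + y + 1) ≤ (ε / 4) ^ 2 := (le_div_iff₀ hxy).1 (min_le_right _ _)
  have hlt : ∀ z : NNReal, (z : ℝ≥0∞) < ENNReal.ofReal (z + t) := by
    intro z
    rw [← ENNReal.ofReal_coe_nnreal, ENNReal.ofReal_lt_ofReal_iff (by positivity)]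
    linarith
  refine ⟨x + t, y + t, hlt x, hlt y, by positivity, by positivity, ?_⟩
  have h1 : √((x + t) * (y + t)) ≤ √(x * y) + ε / 4 := by
    rw [Real.sqrt_le_left (by positivity), add_sq, Real.sq_sqrt (by positivity)]
    have : (0 : ℝ) ≤ 2 * √(x * y) * (ε / 4) := by positivity
    nlinarith
  have h2 : ((x : ℝ≥0∞) * y) ^ (1 / 2 : ℝ) = ENNReal.ofReal √(x * y) := by
    rw [Real.sqrt_eq_rpow, ← ENNReal.ofReal_rpow_of_nonneg (by positivity) (by norm_num),
      ENNReal.ofReal_mul (by positivity), ENNReal.ofReal_coe_nnreal, ENNReal.ofReal_coe_nnreal]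
  have h3 : (3 : ℝ≥0∞) = ENNReal.ofReal 3 := by simp
  have h4 : (24 : ℝ≥0∞) = ENNReal.ofReal 24 := by simp
  rw [h2, h3, h4, ← ENNReal.ofReal_mul (by norm_num), ← ENNReal.ofReal_mul (by norm_num),
    ← ENNReal.ofReal_add (by positivity) (by positivity)]
  apply ENNReal.ofReal_le_ofReal
  have : (0 : ℝ) ≤ √(x * y) := by positivity
  linarith

lemma exists_factor_of_collisionInf_lt {ρ : Matrix (a × c) (a × c) ℂ} (hρ : ρ.PosSemidef)
    (hρ1 : ρ.trace.re = 1) {ε : ℝ} (hε : 0 ≤ ε) {v : ℝ}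
    (hv : collisionInf ε ρ < ENNReal.ofReal v) :
    ∃ (A B : Matrix (a × c) ((a × c) ⊕ (a × c)) ℂ) (S : Matrix c c ℂ), A * Aᴴ = ρ ∧
      hsNorm (A - B) * hsNorm (A + B) ≤ 2 * ε ∧ hsNorm B ^ 2 ≤ 1 ∧ S.PosDef ∧ S.trace = 1 ∧
      collision (B * Bᴴ) S ≤ v := by
  simp only [collisionInf, iInf_lt_iff] at hv
  obtain ⟨τ, hτ, S, hS, h⟩ := hv
  obtain ⟨A, B, hA, hB, hAB⟩ := exists_factor_of_mem_smoothBall hε hρ hρ1.le hτ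
  refine ⟨A, B, S, hA, hAB, ?_, hS.1, hS.2, ?_⟩
  · rw [hsNorm_sq_of_mul_conjTranspose hB]
    exact hτ.2.1
  · rw [hB]
    exact ((ENNReal.ofReal_lt_ofReal_iff_of_nonneg
      (collision_nonneg hS.1 hτ.1.isHermitian.eq)).1 h).le

lemma exists_column_of_maxInf_lt [Nonempty c] {Ψ : Matrix (a × Unit) c ℂ} (hΨ : hsNorm Ψ ^ 2 = 1)
    {ε : ℝ} (hε : 0 ≤ ε) {v : ℝ} (hv0 : 0 < v)
    (hv : maxInf ε (Ψ * Ψᴴ) < ENNReal.ofReal v) :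
    ∃ (D : Matrix (a × c) Unit ℂ) (S : Matrix c c ℂ),
      hsNorm (toColumn Ψ - D) * hsNorm (toColumn Ψ + D) ≤ 2 * ε ∧ S.PosDef ∧ S.trace = 1 ∧
      collision (D * Dᴴ) S ≤ v := by
  simp only [maxInf, iInf_lt_iff] at hv
  obtain ⟨τ, hτ, σ, hσ, h⟩ := hv
  obtain ⟨D, σ', hD, hD1, hσ', hle, htr⟩ :=
    exists_column_of_mem_smoothBall hε hΨ.le hτ hσ.1 hσ.2
  obtain ⟨S, hS, hS1, hSv⟩ := exists_collision_lt (Matrix.posSemidef_self_mul_conjTranspose D)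
    (by rwa [← hsNorm_sq_eq_trace']) hσ' hle
    (htr.trans_lt ((ENNReal.ofReal_lt_ofReal_iff hv0).1 h))
  exact ⟨D, S, hD, hS, hS1, hSv⟩

end Entropy

/-! ### Decoders -/

section Kraus

variable {ι k p q s t : Type*} [Fintype ι] [Fintype k] [Fintype p] [Fintype q] [Fintype s]
  [Fintype t]

/-- The superoperator with Kraus operators `K`. -/
def krausMap (K : ι → Matrix q p ℂ) : Matrix p p ℂ →ₗ[ℂ] Matrix q q ℂ where
  toFun X := ∑ j, K j * X * (K j)ᴴ
  map_add' X Y := by simp only [Matrix.mul_add, Matrix.add_mul, Finset.sum_add_distrib]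
  map_smul' c X := by simp only [Matrix.mul_smul, Matrix.smul_mul, Finset.smul_sum, RingHom.id_apply]

omit [Fintype q] in
lemma applyFst_krausMap [DecidableEq s] (K : ι → Matrix q p ℂ) (X : Matrix (p × s) (p × s) ℂ) :
    applyFst (krausMap K) X
      = ∑ j, (K j ⊗ₖ (1 : Matrix s s ℂ)) * X * (K j ⊗ₖ (1 : Matrix s s ℂ))ᴴ := by
  ext x y
  rw [Matrix.sum_apply, applyFst]
  change (∑ j, K j * (Matrix.of fun k l => X (k, x.2) (l, y.2)) * (K j)ᴴ : Matrix q q ℂ) x.1 y.1 = _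
  rw [Matrix.sum_apply]
  refine Finset.sum_congr rfl fun j _ => ?_
  simp [Matrix.mul_apply, Fintype.sum_prod_type, Matrix.one_apply, Finset.sum_mul, ite_mul,
    apply_ite]

lemma isCPTP_krausMap [DecidableEq p] (K : ι → Matrix q p ℂ) (hK : ∑ j, (K j)ᴴ * K j = 1) :
    IsCPTP (krausMap K) where
  completely_positive n X hX := by
    rw [applyFst_krausMap]
    exact Matrix.posSemidef_sum _ fun j _ => hX.mul_mul_conjTranspose_same _
  trace_preserving X := by
    change (∑ j, K j * X * (K j)ᴴ).trace = _
    rw [Matrix.trace_sum]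
    have : ∀ j, (K j * X * (K j)ᴴ).trace = ((K j)ᴴ * K j * X).trace := fun j => by
      rw [Matrix.trace_mul_comm, Matrix.mul_assoc]
    simp only [this]
    rw [← Matrix.trace_sum, ← Finset.sum_mul, hK, Matrix.one_mul]

/-- The reduced operator on `(output, s)` of the vector with coefficients `Y` on
`((t, s), output)`. -/
def marginal (Y : Matrix (t × s) p ℂ) : Matrix (p × s) (p × s) ℂ :=
  fun x y => ∑ e, Y (e, x.2) x.1 * star (Y (e, y.2) y.1)

/-- The coefficients of a vector on `(q, s)` and `(k ⊕ p, t)`, put together from a part with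
coefficients `G` and an orthogonal part with coefficients `H` and the fixed state `x₀` of `q`. -/
def assemble [DecidableEq q] (x₀ : q) (G : Matrix (t × s) (k × q) ℂ) (H : Matrix (t × s) p ℂ) :
    Matrix (q × s) ((k ⊕ p) × t) ℂ :=
  fun x y => match y.1 with
  | Sum.inl j => G (y.2, x.2) (j, x.1)
  | Sum.inr z => if x.1 = x₀ then H (y.2, x.2) z else 0

lemma hsNorm_assemble_sq [DecidableEq q] (x₀ : q) (G : Matrix (t × s) (k × q) ℂ)
    (H : Matrix (t × s) p ℂ) :
    hsNorm (assemble x₀ G H) ^ 2 = hsNorm G ^ 2 + hsNorm H ^ 2 := by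
  have h1 : ∑ x : q × s, ∑ y : k × t, ‖G (y.2, x.2) (y.1, x.1)‖ ^ 2 = hsNorm G ^ 2 := by
    let φ : (q × s) × (k × t) ≃ (t × s) × (k × q) :=
      { toFun := fun z => ((z.2.2, z.1.2), (z.2.1, z.1.1))
        invFun := fun w => ((w.2.2, w.1.2), (w.2.1, w.1.1))
        left_inv := fun _ => rfl
        right_inv := fun _ => rfl }
    rw [hsNorm_sq, ← Fintype.sum_prod_type', ← Fintype.sum_prod_type']
    exact Fintype.sum_equiv φ _ _ fun _ => rfl
  have h2 : ∑ x : q × s, ∑ y : p × t, ‖(if x.1 = x₀ then H (y.2, x.2) y.1 else 0)‖ ^ 2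
      = hsNorm H ^ 2 := by
    rw [hsNorm_sq]
    simp only [Fintype.sum_prod_type]
    rw [Finset.sum_eq_single_of_mem x₀ (Finset.mem_univ _)]
    · simp only [if_true]
      conv_rhs => rw [Finset.sum_comm]
      refine Finset.sum_congr rfl fun u _ => ?_
      rw [Finset.sum_comm]
    · intro x _ hx
      simp [hx]
  rw [← h1, ← h2, ← Finset.sum_add_distrib, hsNorm_sq]
  refine Finset.sum_congr rfl fun x _ => ?_
  simp only [Fintype.sum_prod_type, Fintype.sum_sum_type]
  rfl

/-- If the purifications `Y` and `X` have nearly the same marginal on `(t, s)`, then some channel on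
the purifying system `p` nearly restores the state of `X` on `(q, s)`. -/
lemma exists_decoder [DecidableEq k] [DecidableEq p] [DecidableEq q] [DecidableEq s]
    [DecidableEq t] [Nonempty q] {Y : Matrix (t × s) p ℂ} {X : Matrix (t × s) (k × q) ℂ} {η : ℝ}
    (hY : hsNorm Y ^ 2 ≤ 1) (hX : hsNorm X ^ 2 ≤ 1) (hη : traceNorm (Y * Yᴴ - X * Xᴴ) ≤ η) :
    ∃ D : Matrix p p ℂ →ₗ[ℂ] Matrix q q ℂ, IsCPTP D ∧
      traceNorm (applyFst D (marginal Y)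
        - marginal fun (z : (t × k) × s) x => X (z.1.1, z.2) (z.1.2, x)) ≤ 2 * √η := by
  obtain ⟨x₀⟩ := ‹Nonempty q›
  obtain ⟨V, hV, hVX⟩ := exists_uhlmann X Y
  rw [traceNorm_sub_comm] at hVX
  set Q := 1 - V * Vᴴ with hQ
  have hQH : Qᴴ = Q := by simp [hQ]
  have hQQ : Q * Q = Q := by
    have := hV.2.eq
    simp only [hQ, Matrix.sub_mul, Matrix.mul_sub, Matrix.one_mul, Matrix.mul_one, this]
    abel
  -- where `V` is not isometric, the decoder prepares the state `x₀`
  let K : k ⊕ p → Matrix q p ℂ := fun j => match j with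
    | Sum.inl j => fun x y => V y (j, x)
    | Sum.inr z => fun x y => if x = x₀ then Q y z else 0
  have hK : ∑ j, (K j)ᴴ * K j = 1 := by
    have h1 : V * Vᴴ + Q * Qᴴ = 1 := by rw [hQH, hQQ, hQ]; abel
    ext x y
    have h2 := congrFun (congrFun h1 y) x
    rw [Matrix.sum_apply, Fintype.sum_sum_type]
    simp only [Matrix.add_apply, Matrix.mul_apply, Matrix.conjTranspose_apply,
      Fintype.sum_prod_type] at h2 ⊢
    simp only [K]
    have h3 : (1 : Matrix p p ℂ) x y = (1 : Matrix p p ℂ) y x := by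
      simp [Matrix.one_apply, eq_comm]
    rw [h3, ← h2]
    simp [mul_comm, apply_ite]
  refine ⟨krausMap K, isCPTP_krausMap K hK, ?_⟩
  have hKY : ∀ (j : k ⊕ p) (x : q) (u : s) (e : t),
      ∑ y, K j x y * Y (e, u) y = assemble x₀ (Y * V) (Y * Q) (x, u) (j, e) := by
    rintro (j | z) x u e
    · simp [K, assemble, Matrix.mul_apply, mul_comm]
    · by_cases hx : x = x₀ <;> simp [K, assemble, Matrix.mul_apply, mul_comm, hx]
  have e1 : applyFst (krausMap K) (marginal Y)
      = assemble x₀ (Y * V) (Y * Q) * (assemble x₀ (Y * V) (Y * Q))ᴴ := by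
    ext x y
    rw [applyFst, Matrix.mul_apply, Fintype.sum_prod_type]
    have hM : (fun k l => marginal Y (k, x.2) (l, y.2) : Matrix p p ℂ)
        = (Matrix.of fun k e => Y (e, x.2) k) * (Matrix.of fun k e => Y (e, y.2) k)ᴴ := by
      ext k l
      simp [marginal, Matrix.mul_apply]
    rw [hM]
    change (∑ j, K j * _ * (K j)ᴴ : Matrix q q ℂ) x.1 y.1 = _
    rw [Matrix.sum_apply]
    refine Finset.sum_congr rfl fun j _ => ?_
    rw [← Matrix.mul_assoc, Matrix.mul_assoc, ← Matrix.conjTranspose_mul, Matrix.mul_apply]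
    refine Finset.sum_congr rfl fun e _ => ?_
    rw [Matrix.conjTranspose_apply, Matrix.conjTranspose_apply, ← hKY, ← hKY, Matrix.mul_apply,
      Matrix.mul_apply]
    rfl
  have e2 : (marginal fun (z : (t × k) × s) x => X (z.1.1, z.2) (z.1.2, x))
      = assemble x₀ X (0 : Matrix (t × s) p ℂ) * (assemble x₀ X (0 : Matrix (t × s) p ℂ))ᴴ := by
    ext x y
    rw [Matrix.mul_apply, Fintype.sum_prod_type_right]
    simp only [marginal]
    rw [Fintype.sum_prod_type]
    refine Finset.sum_congr rfl fun e _ => ?_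
    rw [Fintype.sum_sum_type]
    simp [assemble]
  have h1 : assemble x₀ X 0 - assemble x₀ (Y * V) (Y * Q) = assemble x₀ (X - Y * V) (-(Y * Q)) := by
    ext x ⟨j | z, e⟩
    · simp [assemble]
    · by_cases hx : x.1 = x₀ <;> simp [assemble, hx]
  have h2 : assemble x₀ X 0 + assemble x₀ (Y * V) (Y * Q) = assemble x₀ (X + Y * V) (Y * Q) := by
    ext x ⟨j | z, e⟩
    · simp [assemble]
    · by_cases hx : x.1 = x₀ <;> simp [assemble, hx]
  have h3 : hsNorm (Y * Q) ^ 2 = hsNorm Y ^ 2 - hsNorm (Y * V) ^ 2 := by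
    rw [hsNorm_sq_eq_trace', hsNorm_sq_eq_trace' Y, hsNorm_sq_eq_trace', ← Complex.sub_re,
      ← Matrix.trace_sub, Matrix.conjTranspose_mul, hQH, Matrix.mul_assoc, ← Matrix.mul_assoc Q,
      hQQ, hQ, Matrix.conjTranspose_mul]
    simp only [Matrix.sub_mul, Matrix.mul_sub, Matrix.one_mul, Matrix.mul_assoc]
  have h3' : hsNorm (-(Y * Q)) ^ 2 = hsNorm (Y * Q) ^ 2 := by simp [hsNorm_sq]
  have h4 : hsNorm (assemble x₀ X 0 - assemble x₀ (Y * V) (Y * Q)) ^ 2 ≤ η := by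
    rw [h1, hsNorm_assemble_sq, h3', h3, hsNorm_sub_sq]
    linarith
  have h5 : hsNorm (assemble x₀ X 0 + assemble x₀ (Y * V) (Y * Q)) ^ 2 ≤ 2 ^ 2 := by
    rw [h2, hsNorm_assemble_sq, h3, hsNorm_add_sq]
    have h6 := norm_trace_conjTranspose_mul_le X (Y * V)
    have h7 := Complex.re_le_norm (Xᴴ * (Y * V)).trace
    have h8 := hsNorm_mul_le_of_isPartialIsometry_right hV Y
    have h9 := (sq_le_one_iff₀ (hsNorm_nonneg Y)).1 hY
    have h10 := (sq_le_one_iff₀ (hsNorm_nonneg X)).1 hX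
    have h11 : hsNorm X * hsNorm (Y * V) ≤ 1 :=
      mul_le_one₀ h10 (hsNorm_nonneg _) (h8.trans h9)
    linarith
  rw [e1, e2, traceNorm_sub_comm]
  refine (traceNorm_mul_conjTranspose_sub_le _ _).trans ?_
  rw [mul_comm]
  exact mul_le_mul (abs_le_of_sq_le_sq' h5 zero_le_two).2 (Real.le_sqrt_of_sq_le h4)
    (hsNorm_nonneg _) zero_le_two

end Kraus

/-! ### The protocol -/

section Protocol

variable {A B R A' A'' C E Y : Type*} [Fintype A] [Fintype B] [Fintype R] [Fintype A']
  [Fintype A''] [Fintype C] [Fintype E] [Fintype Y]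

/-- The matrix of coefficients of a bipartite vector. -/
def coeff {a b : Type*} (ψ : a × b → ℂ) : Matrix a b ℂ := fun x y => ψ (x, y)

/-- A matrix from `BR` to `A`, rearranged as a matrix from `B` to `AR`. -/
def shuffle (Ψ : Matrix A (B × R) ℂ) : Matrix (A × R) B ℂ := fun x b => Ψ x.1 (b, x.2)

/-- With `K` the coefficients of a vector on `A'BR`, the coefficients of its image under
`U : A' → CE`, as a matrix from `CB` to `ER`. -/
def outMat (U : Matrix (C × E) A' ℂ) (K : Matrix A' (B × R) ℂ) : Matrix (E × R) (C × B) ℂ :=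
  fun x y => (U * K) (y.1, x.1) (y.2, x.2)

/-- The matrix `∑ g_{ia} σ_{ia'} |a'⟩⟨a|`: the matrix `g` followed by the operator of the state
`σ`. It takes the place of the encoder until it is rounded to a partial isometry. -/
def randomEncoder (g : A'' × A → ℂ) (σ : Matrix A'' A' ℂ) : Matrix A' A ℂ :=
  fun x a => ∑ i, g (i, a) * σ i x

lemma IsKet.hsNorm_coeff {a b : Type*} [Fintype a] [Fintype b] {ψ : a × b → ℂ} (h : IsKet ψ) :
    hsNorm (coeff ψ) ^ 2 = 1 := by
  have h1 := congrArg Complex.re h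
  rw [hsNorm_sq, ← Fintype.sum_prod_type' (f := fun x y => ‖coeff ψ x y‖ ^ 2)]
  simp only [dotProduct, Complex.re_sum, Complex.one_re, Pi.star_apply, Complex.star_def,
    Complex.conj_mul'] at h1
  rw [← h1]
  refine Finset.sum_congr rfl fun x _ => ?_
  norm_cast

lemma hsNorm_shuffle_sq (Ψ : Matrix A (B × R) ℂ) :
    hsNorm (shuffle Ψ) ^ 2 = hsNorm Ψ ^ 2 := by
  simp only [hsNorm_sq, Fintype.sum_prod_type, shuffle]
  exact Finset.sum_congr rfl fun a _ => Finset.sum_comm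

lemma isometry_of_isCPTP [DecidableEq A'] {N : Matrix A' A' ℂ →ₗ[ℂ] Matrix C C ℂ} (hN : IsCPTP N)
    {U : Matrix (C × E) A' ℂ} (hU : IsStinespringDilation N U) : Uᴴ * U = 1 := by
  refine Matrix.ext_iff_trace_mul_right.2 fun X => ?_
  rw [Matrix.one_mul, ← hN.trace_preserving X, hU.dilates X]
  have h : ∀ Z : Matrix (C × E) (C × E) ℂ, (traceSnd Z).trace = Z.trace := fun Z => by
    simp [Matrix.trace, traceSnd, Fintype.sum_prod_type]
  rw [h, conj, Matrix.mul_assoc U, Matrix.trace_mul_comm U, Matrix.mul_assoc X,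
    Matrix.trace_mul_comm X]

lemma hsNorm_mul_of_isometry [DecidableEq A'] {U : Matrix C A' ℂ} (hU : Uᴴ * U = 1)
    (K : Matrix A' Y ℂ) : hsNorm (U * K) ^ 2 = hsNorm K ^ 2 := by
  rw [hsNorm_sq_eq_trace, hsNorm_sq_eq_trace, Matrix.conjTranspose_mul, Matrix.mul_assoc,
    ← Matrix.mul_assoc Uᴴ, hU, Matrix.one_mul]

lemma hsNorm_outMat [DecidableEq A'] {U : Matrix (C × E) A' ℂ} (hU : Uᴴ * U = 1)
    (K : Matrix A' (B × R) ℂ) : hsNorm (outMat U K) = hsNorm K := by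
  rw [← sq_eq_sq₀ (hsNorm_nonneg _) (hsNorm_nonneg _), ← hsNorm_mul_of_isometry hU K, hsNorm_sq,
    hsNorm_sq]
  let φ : (E × R) × (C × B) ≃ (C × E) × (B × R) :=
    { toFun := fun z => ((z.2.1, z.1.1), (z.2.2, z.1.2))
      invFun := fun w => ((w.1.2, w.2.2), (w.1.1, w.2.1))
      left_inv := fun _ => rfl
      right_inv := fun _ => rfl }
  rw [← Fintype.sum_prod_type', ← Fintype.sum_prod_type']
  exact Fintype.sum_equiv φ _ _ fun _ => rfl

omit [Fintype B] [Fintype R] [Fintype C] [Fintype E] in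
lemma outMat_sub (U : Matrix (C × E) A' ℂ) (K L : Matrix A' (B × R) ℂ) :
    outMat U (K - L) = outMat U K - outMat U L := by
  ext x y
  simp [outMat, Matrix.mul_sub]

omit [Fintype B] [Fintype R] [Fintype C] [Fintype E] in
lemma outMat_add (U : Matrix (C × E) A' ℂ) (K L : Matrix A' (B × R) ℂ) :
    outMat U (K + L) = outMat U K + outMat U L := by
  ext x y
  simp [outMat, Matrix.mul_add]

omit [Fintype B] [Fintype R] [Fintype C] [Fintype E] in
lemma twistSqrt_eq_outMat (g : A'' × A → ℂ) (σ : Matrix A'' A' ℂ) (U : Matrix (C × E) A' ℂ)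
    (Ψ : Matrix A (B × R) ℂ) :
    twistSqrt g (shuffle (σ * Uᵀ)) (shuffle Ψ) = outMat U (randomEncoder g σ * Ψ) := by
  ext x y
  simp only [twistSqrt, shuffle, outMat, Matrix.mul_apply, randomEncoder, Matrix.transpose_apply,
    Fintype.sum_prod_type, Finset.sum_mul, Finset.mul_sum]
  rw [Finset.sum_comm]
  conv_rhs => rw [Finset.sum_comm]
  refine Finset.sum_congr rfl fun a _ => ?_
  rw [Finset.sum_comm]
  refine Finset.sum_congr rfl fun z _ => Finset.sum_congr rfl fun i _ => ?_
  ring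

omit [Fintype A'] [Fintype Y] in
lemma twistSqrt_eq_randomEncoder (g : A'' × A → ℂ) (σ : Matrix A'' A' ℂ) (Ψ : Matrix A Y ℂ)
    (x : Unit × Y) (y : A' × Unit) :
    twistSqrt g (σ.submatrix Prod.fst id : Matrix (A'' × Unit) A' ℂ)
      (toColumn (Ψ.submatrix Prod.fst id)) x y = (randomEncoder g σ * Ψ) y.1 x.2 := by
  simp only [twistSqrt, toColumn, Matrix.submatrix_apply, id, Matrix.mul_apply, randomEncoder,
    Fintype.sum_prod_type, Finset.sum_mul]
  rw [Finset.sum_comm]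
  refine Finset.sum_congr rfl fun a _ => Finset.sum_congr rfl fun i _ => ?_
  ring

omit [Fintype A] [Fintype R] in
lemma traceMid_ketbra (ψ : A × B × R → ℂ) :
    traceMid (ketbra ψ) = shuffle (coeff ψ) * (shuffle (coeff ψ))ᴴ := by
  ext x y
  simp [traceMid, ketbra, shuffle, coeff, Matrix.mul_apply, Matrix.vecMulVec_apply]

omit [Fintype A] in
lemma traceSnd_ketbra (ψ : A × Y → ℂ) :
    traceSnd (ketbra ψ) = coeff ψ * (coeff ψ)ᴴ := by
  ext x y
  simp [traceSnd, ketbra, coeff, Matrix.mul_apply, Matrix.vecMulVec_apply]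

omit [Fintype A] in
lemma uncond_mul_conjTranspose (M : Matrix A Y ℂ) :
    uncond (M * Mᴴ) = (M.submatrix Prod.fst id : Matrix (A × Unit) Y ℂ)
      * (M.submatrix Prod.fst id : Matrix (A × Unit) Y ℂ)ᴴ := by
  ext x y
  simp [uncond, Matrix.mul_apply]

omit [Fintype Y] in
lemma conj_ketbra [DecidableEq A''] (M : Matrix Y A' ℂ) (σ : A'' × A' → ℂ) :
    ∃ χ : A'' × Y → ℂ, conj ((1 : Matrix A'' A'' ℂ) ⊗ₖ M) (ketbra σ) = ketbra χ ∧
      coeff χ = coeff σ * Mᵀ := by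
  refine ⟨((1 : Matrix A'' A'' ℂ) ⊗ₖ M).mulVec σ, ?_, ?_⟩
  · rw [conj, ketbra, ketbra, Matrix.mul_vecMulVec, Matrix.vecMulVec_mul, ← Matrix.star_mulVec]
  · ext x y
    simp [coeff, Matrix.mulVec, dotProduct, Fintype.sum_prod_type, Matrix.one_apply,
      Matrix.mul_apply, mul_comm]

omit [Fintype E] in
/-- The state of the environment and the reference after encoding. -/
lemma applyFst_complementary [DecidableEq R] (U : Matrix (C × E) A' ℂ) (V : Matrix A' A ℂ)
    (Ψ : Matrix A (B × R) ℂ) :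
    applyFst (complementary U) (conj (V ⊗ₖ (1 : Matrix R R ℂ)) (shuffle Ψ * (shuffle Ψ)ᴴ))
      = outMat U (V * Ψ) * (outMat U (V * Ψ))ᴴ := by
  have h1 : conj (V ⊗ₖ (1 : Matrix R R ℂ)) (shuffle Ψ * (shuffle Ψ)ᴴ)
      = shuffle (V * Ψ) * (shuffle (V * Ψ))ᴴ := by
    have : (V ⊗ₖ (1 : Matrix R R ℂ)) * shuffle Ψ = shuffle (V * Ψ) := by
      ext x y
      simp [shuffle, Matrix.mul_apply, Fintype.sum_prod_type, Matrix.one_apply]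
    rw [← this, Matrix.conjTranspose_mul, conj]
    simp only [Matrix.mul_assoc]
  rw [h1]
  generalize V * Ψ = K
  ext x y
  have h2 : (fun k l => (shuffle K * (shuffle K)ᴴ) (k, x.2) (l, y.2) : Matrix A' A' ℂ)
      = K.submatrix id (fun b => (b, x.2)) * (K.submatrix id (fun b => (b, y.2)))ᴴ := by
    ext k l
    simp [shuffle, Matrix.mul_apply]
  rw [applyFst, h2]
  change traceFst (conj U _) x.1 y.1 = _
  have h3 : conj U (K.submatrix id (fun b => (b, x.2)) * (K.submatrix id (fun b => (b, y.2)))ᴴ)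
      = (U * K).submatrix id (fun b => (b, x.2)) * ((U * K).submatrix id (fun b => (b, y.2)))ᴴ := by
    have h4 : ∀ r : R, U * K.submatrix id (fun b => (b, r))
        = (U * K).submatrix id (fun b => (b, r)) := fun r => rfl
    rw [← h4, ← h4, Matrix.conjTranspose_mul, conj]
    simp only [Matrix.mul_assoc]
  rw [h3, Matrix.mul_apply, Fintype.sum_prod_type]
  rfl

/-- The state of the receiver and the reference after encoding and transmission. -/
lemma assoc_applyFst [DecidableEq B] [DecidableEq R] {N : Matrix A' A' ℂ →ₗ[ℂ] Matrix C C ℂ}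
    {U : Matrix (C × E) A' ℂ} (hU : IsStinespringDilation N U) (V : Matrix A' A ℂ)
    (ψ : A × B × R → ℂ) :
    assoc (applyFst N (conj (V ⊗ₖ (1 : Matrix (B × R) (B × R) ℂ)) (ketbra ψ)))
      = marginal (outMat U (V * coeff ψ)) := by
  obtain ⟨K, hK⟩ : ∃ K, K = V * coeff ψ := ⟨_, rfl⟩
  have h1 : conj (V ⊗ₖ (1 : Matrix (B × R) (B × R) ℂ)) (ketbra ψ)
      = ketbra fun x => K x.1 x.2 := by
    have : (V ⊗ₖ (1 : Matrix (B × R) (B × R) ℂ)).mulVec ψ = fun x => K x.1 x.2 := by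
      ext x
      simp [hK, coeff, Matrix.mulVec, dotProduct, Fintype.sum_prod_type, Matrix.one_apply,
        Matrix.mul_apply]
    rw [conj, ketbra, ketbra, Matrix.mul_vecMulVec, Matrix.vecMulVec_mul, ← Matrix.star_mulVec,
      this]
  rw [h1, ← hK]
  ext x y
  change N (Matrix.vecMulVec (fun k => K k (x.1.2, x.2)) (star fun k => K k (y.1.2, y.2)))
    x.1.1 y.1.1 = _
  rw [hU.dilates, conj, Matrix.mul_vecMulVec, Matrix.vecMulVec_mul, ← Matrix.star_mulVec]
  rfl

/-- Rounding a matrix to a partial isometry: if `K` and `Ψ` have nearly the same marginal, some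
partial isometry takes `Ψ` near `K`. -/
lemma exists_encoder [DecidableEq A] [DecidableEq A'] [DecidableEq Y] (K : Matrix A' Y ℂ)
    (Ψ : Matrix A Y ℂ) : ∃ V : Matrix A' A ℂ, IsPartialIsometry V ∧
      hsNorm (K - V * Ψ) ^ 2 ≤ traceNorm (Kᵀ * Kᵀᴴ - Ψᵀ * Ψᵀᴴ) := by
  obtain ⟨V, hV, h⟩ := exists_uhlmann Kᵀ Ψᵀ
  refine ⟨Vᵀ, hV.transpose, ?_⟩
  have h1 : hsNorm (K - Vᵀ * Ψ) ^ 2 = hsNorm (Kᵀ - Ψᵀ * V) ^ 2 := by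
    have : Kᵀ - Ψᵀ * V = (K - Vᵀ * Ψ)ᵀ := by
      rw [Matrix.transpose_sub, Matrix.transpose_mul, Matrix.transpose_transpose]
    rw [this, hsNorm_sq, hsNorm_sq, Finset.sum_comm]
    rfl
  have h2 : hsNorm (Ψᵀ * V) ^ 2 ≤ hsNorm Ψᵀ ^ 2 := by
    gcongr
    · exact hsNorm_nonneg _
    · exact hsNorm_mul_le_of_isPartialIsometry_right hV _
  rw [h1, hsNorm_sub_sq]
  linarith

lemma exists_le_two_mul {ι : Type*} [Fintype ι] [Nonempty ι] {f h : ι → ℝ} {x y : ℝ}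
    (hf0 : ∀ j, 0 ≤ f j) (hh0 : ∀ j, 0 ≤ h j) (hx : 0 < x) (hy : 0 < y)
    (hf : ∑ j, f j ≤ Fintype.card ι * x) (hh : ∑ j, h j ≤ Fintype.card ι * y) :
    ∃ j, f j ≤ 2 * x ∧ h j ≤ 2 * y := by
  have h1 : ∑ j, (f j / x + h j / y) ≤ ∑ _j : ι, (2 : ℝ) := by
    rw [Finset.sum_add_distrib, ← Finset.sum_div, ← Finset.sum_div, Finset.sum_const,
      Finset.card_univ, nsmul_eq_mul]
    have := (div_le_iff₀ hx).2 hf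
    have := (div_le_iff₀ hy).2 hh
    linarith
  obtain ⟨j, -, hj⟩ := Finset.exists_le_of_sum_le Finset.univ_nonempty h1
  have h2 := div_nonneg (hf0 j) hx.le
  have h3 := div_nonneg (hh0 j) hy.le
  exact ⟨j, (div_le_iff₀ hx).1 (by linarith), (div_le_iff₀ hy).1 (by linarith)⟩

lemma sqrt_mul_one_add_sqrt_le {d D : ℝ} (hD : 0 ≤ D) (hD1 : D ≤ 1) (h : d ≤ 7 / 10 * D) :
    √d * (1 + √(1 + d)) ≤ 2 * √D := by
  have h1 : √d ≤ 21 / 25 * √D := by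
    rw [Real.sqrt_le_left (by positivity), mul_pow, Real.sq_sqrt hD]
    linarith
  have h2 : √(1 + d) ≤ 33 / 25 := by
    rw [Real.sqrt_le_left (by norm_num)]
    linarith
  calc √d * (1 + √(1 + d)) ≤ (21 / 25 * √D) * (1 + 33 / 25) := by gcongr
    _ ≤ 2 * √D := by nlinarith [Real.sqrt_nonneg D]

end Protocol

section Main

variable {A B R A' A'' C E Y : Type*} [Fintype A] [Fintype B] [Fintype R] [Fintype A']
  [Fintype A''] [Fintype C] [Fintype E] [Fintype Y]

/-- The purification of `ω^E ⊗ ψ^R` by the product of the purifications `Ω` and `Ψ`. -/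
def productPurification (Ω : Matrix (A'' × E) C ℂ) (Ψ : Matrix A (B × R) ℂ) :
    Matrix (E × R) ((A'' × C) × (A × B)) ℂ :=
  fun x y => Ω (y.1.1, x.1) y.1.2 * Ψ y.2.1 (y.2.2, x.2)

omit [Fintype R] [Fintype E] in
lemma productPurification_mul_conjTranspose (Ω : Matrix (A'' × E) C ℂ) (Ψ : Matrix A (B × R) ℂ) :
    productPurification Ω Ψ * (productPurification Ω Ψ)ᴴ
      = traceFst (Ω * Ωᴴ) ⊗ₖ traceFst (shuffle Ψ * (shuffle Ψ)ᴴ) := by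
  ext x y
  simp only [Matrix.mul_apply, productPurification, Matrix.conjTranspose_apply,
    Matrix.kroneckerMap_apply, traceFst, shuffle]
  rw [← Fintype.sum_prod_type', ← Fintype.sum_prod_type', Finset.sum_mul_sum,
    ← Fintype.sum_prod_type']
  refine Finset.sum_congr rfl fun z _ => ?_
  rw [star_mul']
  ring

lemma trace_traceFst (Z : Matrix (A × B) (A × B) ℂ) : (traceFst Z).trace = Z.trace := by
  simp only [Matrix.trace, traceFst, Matrix.diag_apply, Fintype.sum_prod_type]
  exact Finset.sum_comm

lemma trace_mul_conjTranspose (M : Matrix A B ℂ) :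
    (M * Mᴴ).trace = ((hsNorm M ^ 2 : ℝ) : ℂ) := by
  rw [hsNorm_sq_eq_trace']
  refine Complex.ext rfl ?_
  simpa using (Complex.le_def.1 (Matrix.posSemidef_self_mul_conjTranspose M).trace_nonneg).2.symm

lemma hsNorm_productPurification (Ω : Matrix (A'' × E) C ℂ) (Ψ : Matrix A (B × R) ℂ)
    (hΩ : hsNorm Ω ^ 2 = 1) (hΨ : hsNorm Ψ ^ 2 = 1) : hsNorm (productPurification Ω Ψ) ^ 2 = 1 := by
  rw [hsNorm_sq_eq_trace', productPurification_mul_conjTranspose, Matrix.trace_kronecker,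
    trace_traceFst, trace_traceFst, trace_mul_conjTranspose, trace_mul_conjTranspose,
    hsNorm_shuffle_sq, hΩ, hΨ]
  simp

omit [Fintype A] [Fintype B] [Fintype R] in
lemma marginal_productPurification (Ω : Matrix (A'' × E) C ℂ) (hΩ : hsNorm Ω ^ 2 = 1)
    (ψ : A × B × R → ℂ) :
    (marginal fun (z : (E × (A'' × C)) × R) x =>
      productPurification Ω (coeff ψ) (z.1.1, z.2) (z.1.2, x)) = assoc (ketbra ψ) := by
  ext x y
  have h1 : ∑ z : E × (A'' × C), Ω (z.2.1, z.1) z.2.2 * star (Ω (z.2.1, z.1) z.2.2) = 1 := by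
    have h2 := trace_mul_conjTranspose Ω
    rw [hΩ, Complex.ofReal_one] at h2
    rw [← h2]
    simp only [Matrix.trace, Matrix.diag_apply, Matrix.mul_apply, Matrix.conjTranspose_apply,
      Fintype.sum_prod_type]
    rw [Finset.sum_comm]
  simp only [marginal, productPurification]
  have h3 : ∀ z : E × (A'' × C), Ω (z.2.1, z.1) z.2.2 * coeff ψ x.1.1 (x.1.2, x.2)
        * star (Ω (z.2.1, z.1) z.2.2 * coeff ψ y.1.1 (y.1.2, y.2))
      = Ω (z.2.1, z.1) z.2.2 * star (Ω (z.2.1, z.1) z.2.2)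
        * (coeff ψ x.1.1 (x.1.2, x.2) * star (coeff ψ y.1.1 (y.1.2, y.2))) := fun z => by
    rw [star_mul']
    ring
  rw [Finset.sum_congr rfl fun z _ => h3 z, ← Finset.sum_mul, h1, one_mul]
  rfl

lemma trace_re_sub_le_traceNorm [DecidableEq Y] (X Z : Matrix Y Y ℂ) :
    X.trace.re - Z.trace.re ≤ traceNorm (X - Z) := by
  have h : IsPartialIsometry (1 : Matrix Y Y ℂ) := by
    simp [IsPartialIsometry, IsIdempotentElem]
  simpa using trace_mul_re_le_traceNorm h (X - Z)

lemma hsNorm_transpose (M : Matrix A Y ℂ) : hsNorm Mᵀ = hsNorm M := by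
  rw [← sq_eq_sq₀ (hsNorm_nonneg _) (hsNorm_nonneg _), hsNorm_sq, hsNorm_sq, Finset.sum_comm]
  rfl

lemma hsNorm_submatrix_snd (M : Matrix A Y ℂ) :
    hsNorm (M.submatrix id Prod.snd : Matrix A (Unit × Y) ℂ) ^ 2 = hsNorm M ^ 2 := by
  simp [hsNorm_sq, Fintype.sum_prod_type]

/-- If the random encoder leaves the state of `Y` nearly unchanged, it can be rounded to a partial
isometry. -/
lemma exists_encoder_of_twist [DecidableEq A] [DecidableEq A'] [DecidableEq Y] (g : A'' × A → ℂ)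
    {σ : Matrix A'' A' ℂ} {Ψ : Matrix A Y ℂ} (hσ : hsNorm σ ^ 2 = 1) (hΨ : hsNorm Ψ ^ 2 = 1) {d : ℝ}
    (hd : traceNorm (twist g (uncond (σ * σᴴ))
        (toColumn (Ψ.submatrix Prod.fst id) * (toColumn (Ψ.submatrix Prod.fst id))ᴴ)
      - traceFst (uncond (σ * σᴴ)) ⊗ₖ
        traceFst (toColumn (Ψ.submatrix Prod.fst id)
          * (toColumn (Ψ.submatrix Prod.fst id))ᴴ)) ≤ d) :
    ∃ V : Matrix A' A ℂ, IsPartialIsometry V ∧ hsNorm (V * Ψ - randomEncoder g σ * Ψ) ^ 2 ≤ d ∧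
      hsNorm (randomEncoder g σ * Ψ) ^ 2 ≤ 1 + d := by
  set K := randomEncoder g σ * Ψ with hK
  let K' : Matrix A' (Unit × Y) ℂ := K.submatrix id Prod.snd
  let Ψ' : Matrix A (Unit × Y) ℂ := Ψ.submatrix id Prod.snd
  have e1 : twist g (uncond (σ * σᴴ))
      (toColumn (Ψ.submatrix Prod.fst id) * (toColumn (Ψ.submatrix Prod.fst id))ᴴ)
      = K'ᵀ * K'ᵀᴴ := by
    rw [uncond_mul_conjTranspose, ← twistSqrt_mul_conjTranspose]
    ext x y
    simp only [Matrix.mul_apply, Matrix.conjTranspose_apply, twistSqrt_eq_randomEncoder,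
      Fintype.sum_prod_type]
    simp [K', hK, Matrix.mul_apply]
  have e2 : traceFst (uncond (σ * σᴴ)) ⊗ₖ
      traceFst (toColumn (Ψ.submatrix Prod.fst id) * (toColumn (Ψ.submatrix Prod.fst id))ᴴ)
      = Ψ'ᵀ * Ψ'ᵀᴴ := by
    have h1 : ∀ u v : Unit, traceFst (uncond (σ * σᴴ)) u v = 1 := by
      intro u v
      have h2 := trace_mul_conjTranspose σ
      rw [hσ, Complex.ofReal_one] at h2
      exact h2
    ext x y
    rw [Matrix.kroneckerMap_apply, h1, one_mul]
    simp [traceFst, toColumn, Matrix.mul_apply, Ψ']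
  rw [e1, e2] at hd
  obtain ⟨V, hV, h⟩ := exists_encoder K' Ψ'
  refine ⟨V, hV, ?_, ?_⟩
  · have h1 : K' - V * Ψ' = (K - V * Ψ).submatrix id Prod.snd := rfl
    rw [h1, hsNorm_submatrix_snd] at h
    have h2 : hsNorm (V * Ψ - K) ^ 2 = hsNorm (K - V * Ψ) ^ 2 := by
      simp [hsNorm_sq, norm_sub_rev]
    rw [h2]
    exact h.trans hd
  · have h2 := (trace_re_sub_le_traceNorm (K'ᵀ * K'ᵀᴴ) (Ψ'ᵀ * Ψ'ᵀᴴ)).trans hd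
    rw [← hsNorm_sq_eq_trace', ← hsNorm_sq_eq_trace', hsNorm_transpose, hsNorm_transpose,
      hsNorm_submatrix_snd, hsNorm_submatrix_snd, hΨ] at h2
    linarith

lemma trace_re_eq_one {M : Matrix A B ℂ} (h : hsNorm M ^ 2 = 1) : (M * Mᴴ).trace.re = 1 := by
  rw [← hsNorm_sq_eq_trace', h]

lemma ofReal_two_mul_sqrt_le {x : ℝ} {y : ℝ≥0∞} (h : ENNReal.ofReal x ≤ y) :
    ENNReal.ofReal (2 * √x) ≤ 2 * y ^ (1 / 2 : ℝ) := by
  have h1 : ENNReal.ofReal √x = ENNReal.ofReal x ^ (1 / 2 : ℝ) := by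
    rcases le_total 0 x with hx | hx
    · rw [Real.sqrt_eq_rpow, ENNReal.ofReal_rpow_of_nonneg hx (by norm_num)]
    · simp [Real.sqrt_eq_zero_of_nonpos hx, ENNReal.ofReal_of_nonpos hx]
  rw [ENNReal.ofReal_mul zero_le_two, h1, ENNReal.ofReal_ofNat]
  gcongr

end Main

end QDecoupling

end

open QDecoupling in
theorem mainTheorem4
    {A B R A' A'' C E : Type*}
    [Fintype A] [DecidableEq A] [Fintype B] [DecidableEq B] [Fintype R] [DecidableEq R]
    [Fintype A'] [DecidableEq A'] [Fintype A''] [DecidableEq A'']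
    [Fintype C] [DecidableEq C] [Fintype E] [DecidableEq E]
    -- the pure state `ψ` on `ABR`
    (ψ : A × B × R → ℂ) (hψ : IsKet ψ)
    -- the channel, with a Stinespring dilation
    (N : Matrix A' A' ℂ →ₗ[ℂ] Matrix C C ℂ) (hN : IsCPTP N)
    (U : Matrix (C × E) A' ℂ) (hU : IsStinespringDilation N U)
    -- the pure state `σ` on `A''A'`
    (hA : Fintype.card A'' = Fintype.card A')
    (σ : A'' × A' → ℂ) (hσ : IsKet σ)
    (ε : ℝ) (hε : 0 < ε) :
    let ψAR : Matrix (A × R) (A × R) ℂ := traceMid (ketbra ψ)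
    let ψA : Matrix A A ℂ := traceSnd (ketbra ψ)
    let ψR : Matrix R R ℂ := traceFst ψAR
    let ω : Matrix (A'' × C × E) (A'' × C × E) ℂ := conj ((1 : Matrix A'' A'' ℂ) ⊗ₖ U) (ketbra σ)
    let ωAE : Matrix (A'' × E) (A'' × E) ℂ := traceMid ω
    let ωA : Matrix A'' A'' ℂ := traceSnd ω
    let ωE : Matrix E E ℂ := traceFst ωAE
    let δ₁ : ℝ≥0∞ :=
      3 * pow2 (((1 / 2 : ℝ) : EReal) * Hmaxsmooth ε (uncond ψA)
        - ((1 / 2 : ℝ) : EReal) * H2smooth ε (uncond ωA)) + 24 * ENNReal.ofReal ε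
    let δ₂ : ℝ≥0∞ :=
      3 * pow2 (-(((1 / 2 : ℝ) : EReal) * H2smooth ε ωAE)
        - ((1 / 2 : ℝ) : EReal) * H2smooth ε ψAR) + 24 * ENNReal.ofReal ε
    ∃ (V : Matrix A' A ℂ) (D : Matrix (C × B) (C × B) ℂ →ₗ[ℂ] Matrix (A × B) (A × B) ℂ),
      IsPartialIsometry V ∧ IsCPTP D ∧
      ENNReal.ofReal (traceNorm
          (applyFst (complementary U) (conj (V ⊗ₖ (1 : Matrix R R ℂ)) ψAR) - ωE ⊗ₖ ψR))
        ≤ 2 * δ₁ ^ (1 / 2 : ℝ) + δ₂ ∧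
      ENNReal.ofReal (traceNorm
          (applyFst D (assoc (applyFst N
            (conj (V ⊗ₖ (1 : Matrix (B × R) (B × R) ℂ)) (ketbra ψ)))) - assoc (ketbra ψ)))
        ≤ 2 * (2 * δ₁ ^ (1 / 2 : ℝ) + δ₂) ^ (1 / 2 : ℝ) := by
  intro ψAR ψA ψR ω ωAE ωA ωE δ₁ δ₂
  have hε0 := hε.le
  have hΨ1 : hsNorm (coeff ψ) ^ 2 = 1 := hψ.hsNorm_coeff
  have hσ1 : hsNorm (coeff σ) ^ 2 = 1 := hσ.hsNorm_coeff
  have hiso : Uᴴ * U = 1 := isometry_of_isCPTP hN hU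
  have hne : Nonempty (A × B × R) := by
    by_contra h
    rw [not_nonempty_iff] at h
    simp [IsKet, dotProduct] at hψ
  have hneAB : Nonempty (A × B) := hne.map fun x => (x.1, x.2.1)
  have hneBR : Nonempty (B × R) := hne.map Prod.snd
  obtain ⟨χ, hω, hχ⟩ := conj_ketbra U σ
  set Ω := shuffle (coeff σ * Uᵀ) with hΩ
  -- the operators of the statement through their purifications
  have eψAR : ψAR = shuffle (coeff ψ) * (shuffle (coeff ψ))ᴴ := traceMid_ketbra ψ
  have eψA : ψA = coeff ψ * (coeff ψ)ᴴ := traceSnd_ketbra ψ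
  have eωAE : ωAE = Ω * Ωᴴ := by
    change traceMid (conj _ _) = _
    rw [hω, traceMid_ketbra, hχ]
  have eωA : ωA = coeff σ * (coeff σ)ᴴ := by
    change traceSnd (conj _ _) = _
    rw [hω, traceSnd_ketbra, hχ, Matrix.conjTranspose_mul, Matrix.mul_assoc, ← Matrix.mul_assoc Uᵀ]
    have : Uᵀ * Uᵀᴴ = (Uᴴ * U)ᵀ := by
      rw [Matrix.transpose_mul]; rfl
    rw [this, hiso, Matrix.transpose_one, Matrix.one_mul]
  have hΩ1 : hsNorm Ω ^ 2 = 1 := by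
    rw [hΩ, hsNorm_shuffle_sq, ← hsNorm_transpose, Matrix.transpose_mul, Matrix.transpose_transpose,
      hsNorm_mul_of_isometry hiso, hsNorm_transpose, hσ1]
  have eψAu := congrArg uncond eψA
  have eωAu := congrArg uncond eωA
  rw [uncond_mul_conjTranspose] at eψAu eωAu
  set Ψu : Matrix (A × Unit) (B × R) ℂ := (coeff ψ).submatrix Prod.fst id with hΨu
  set σu : Matrix (A'' × Unit) A' ℂ := (coeff σ).submatrix Prod.fst id with hσu
  have hΨu1 : hsNorm Ψu ^ 2 = 1 := by
    rw [← hΨ1]; simp [hsNorm_sq, Fintype.sum_prod_type, hΨu]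
  have hσu1 : hsNorm σu ^ 2 = 1 := by
    rw [← hσ1]; simp [hsNorm_sq, Fintype.sum_prod_type, hσu]
  have hsh1 : hsNorm (shuffle (coeff ψ)) ^ 2 = 1 := by rw [hsNorm_shuffle_sq, hΨ1]
  have hcol1 : hsNorm (toColumn Ψu) ^ 2 = 1 := by
    rw [hsNorm_sq_eq_trace, trace_toColumn, ← hsNorm_sq_eq_trace, hΨu1]
  have hσup := trace_re_eq_one hσu1
  have hψup := trace_re_eq_one hΨu1
  have hΩp := trace_re_eq_one hΩ1
  have hshp := trace_re_eq_one hsh1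
  have hδ₁ : δ₁ = 3 * (maxInf ε (Ψu * Ψuᴴ) * collisionInf ε (σu * σuᴴ)) ^ (1 / 2 : ℝ)
      + 24 * ENNReal.ofReal ε := by
    rw [← eψAu, ← eωAu, ← pow2_Hmaxsmooth_sub]
  have hδ₂ : δ₂ = 3 * (collisionInf ε (Ω * Ωᴴ)
      * collisionInf ε (shuffle (coeff ψ) * (shuffle (coeff ψ))ᴴ)) ^ (1 / 2 : ℝ)
      + 24 * ENNReal.ofReal ε := by
    rw [← eωAE, ← eψAR, ← pow2_neg_H2smooth_sub]
  -- near-optimal points of the smoothing balls, and the states that witness their entropies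
  obtain ⟨u₁, v₁, hu₁, hv₁, hu₁0, hv₁0, hb₁⟩ := exists_approx_mul
    (maxInf_ne_top (Matrix.posSemidef_self_mul_conjTranspose Ψu) hψup hε0)
    (collisionInf_ne_top (Matrix.posSemidef_self_mul_conjTranspose σu) hσup hε0) hε
  obtain ⟨u₂, v₂, hu₂, hv₂, hu₂0, hv₂0, hb₂⟩ := exists_approx_mul
    (collisionInf_ne_top (Matrix.posSemidef_self_mul_conjTranspose Ω) hΩp hε0)
    (collisionInf_ne_top (Matrix.posSemidef_self_mul_conjTranspose (shuffle (coeff ψ))) hshp hε0) hε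
  obtain ⟨A₁, B₁, S₁, hA₁, hAB₁, hB₁, hS₁, hS₁t, hc₁⟩ := exists_factor_of_collisionInf_lt
    (Matrix.posSemidef_self_mul_conjTranspose σu) hσup hε0 hv₁
  obtain ⟨D₁, T₁, hD₁, hT₁, hT₁t, hcT₁⟩ := exists_column_of_maxInf_lt hΨu1 hε0 hu₁0 hu₁
  obtain ⟨A₂, B₂, S₂, hA₂, hAB₂, hB₂, hS₂, hS₂t, hc₂⟩ := exists_factor_of_collisionInf_lt
    (Matrix.posSemidef_self_mul_conjTranspose Ω) hΩp hε0 hu₂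
  obtain ⟨C₂, D₂, T₂, hC₂, hCD₂, hD₂, hT₂, hT₂t, hcT₂⟩ := exists_factor_of_collisionInf_lt
    (Matrix.posSemidef_self_mul_conjTranspose (shuffle (coeff ψ))) hshp hε0 hv₂
  set x₁ := √(u₁ * v₁) + 8 * ε with hx₁
  set x₂ := √(u₂ * v₂) + 8 * ε with hx₂
  have hx₁0 : 0 < x₁ := by positivity
  have hx₂0 : 0 < x₂ := by positivity
  have hs₁ := sum_traceNorm_twist_sub_le (i := A'') (a := A) hAB₁ hD₁ hB₁ hcol1.le hS₁ hT₁ hS₁t hT₁t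
  have hs₂ := sum_traceNorm_twist_sub_le (i := A'') (a := A) hAB₂ hCD₂ hB₂
    (by rw [hsNorm_sq_of_mul_conjTranspose hC₂, hshp]) hS₂ hT₂ hS₂t hT₂t
  rw [hA₁] at hs₁
  rw [hA₂, hC₂] at hs₂
  have hle₁ : √(collision (B₁ * B₁ᴴ) S₁ * collision (D₁ * D₁ᴴ) T₁) + 8 * ε ≤ x₁ := by
    rw [hx₁, mul_comm u₁]
    gcongr
    exact collision_nonneg hT₁ (Matrix.posSemidef_self_mul_conjTranspose D₁).isHermitian.eq
  have hle₂ : √(collision (B₂ * B₂ᴴ) S₂ * collision (D₂ * D₂ᴴ) T₂) + 8 * ε ≤ x₂ := by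
    rw [hx₂]
    gcongr
    exact collision_nonneg hT₂ (Matrix.posSemidef_self_mul_conjTranspose D₂).isHermitian.eq
  -- one choice of phases is within a factor `2` of both averages
  obtain ⟨f, hf₁, hf₂⟩ := exists_le_two_mul (fun _ => traceNorm_nonneg _)
    (fun _ => traceNorm_nonneg _) hx₁0 hx₂0
    (hs₁.trans (mul_le_mul_of_nonneg_left hle₁ (Nat.cast_nonneg _)))
    (hs₂.trans (mul_le_mul_of_nonneg_left hle₂ (Nat.cast_nonneg _)))
  rw [hσu, ← uncond_mul_conjTranspose] at hf₁
  have hX : productPurification Ω (coeff ψ) * (productPurification Ω (coeff ψ))ᴴ = ωE ⊗ₖ ψR := by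
    rw [productPurification_mul_conjTranspose, ← eωAE, ← eψAR]
  have hX1 := hsNorm_productPurification Ω (coeff ψ) hΩ1 hΨ1
  obtain ⟨V, hV, hV₁, hV₂⟩ := exists_encoder_of_twist (phase f) hσ1 hΨ1 hf₁
  set d₁ := 10 / 7 * (2 * x₁) with hd₁
  set d₂ := 10 / 7 * (2 * x₂) with hd₂
  have hd₁δ : ENNReal.ofReal d₁ ≤ δ₁ := by rw [hδ₁]; exact hb₁
  have hd₂δ : ENNReal.ofReal d₂ ≤ δ₂ := by rw [hδ₂]; exact hb₂
  have hVΨ : hsNorm (V * coeff ψ) ^ 2 ≤ 1 := by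
    rw [← hΨ1]
    gcongr
    · exact hsNorm_nonneg _
    · exact hsNorm_mul_le_of_isPartialIsometry hV _
  -- the decoupling of the environment from the reference
  obtain ⟨η, hηδ, hdec⟩ : ∃ η : ℝ, ENNReal.ofReal η ≤ 2 * δ₁ ^ (1 / 2 : ℝ) + δ₂ ∧
      traceNorm (outMat U (V * coeff ψ) * (outMat U (V * coeff ψ))ᴴ - ωE ⊗ₖ ψR) ≤ η := by
    by_cases hδ : 1 ≤ δ₁
    · -- the bound exceeds the sum of the trace norms of the two states
      refine ⟨2, ?_, ?_⟩
      · rw [ENNReal.ofReal_ofNat]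
        calc (2 : ℝ≥0∞) = 2 * 1 ^ (1 / 2 : ℝ) := by norm_num
          _ ≤ 2 * δ₁ ^ (1 / 2 : ℝ) := by gcongr
          _ ≤ _ := le_self_add
      · rw [sub_eq_add_neg]
        refine (traceNorm_add_le _ _).trans ?_
        rw [traceNorm_neg, ← hX,
          traceNorm_of_posSemidef (Matrix.posSemidef_self_mul_conjTranspose _),
          traceNorm_of_posSemidef (Matrix.posSemidef_self_mul_conjTranspose _),
          ← hsNorm_sq_eq_trace', ← hsNorm_sq_eq_trace', hX1, hsNorm_outMat hiso]
        linarith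
    · push Not at hδ
      have hd₁1 : d₁ ≤ 1 := by
        have := (hd₁δ.trans_lt hδ).le
        rwa [ENNReal.ofReal_le_one] at this
      refine ⟨2 * √d₁ + d₂, ?_, ?_⟩
      · rw [ENNReal.ofReal_add (by positivity) (by positivity)]
        exact add_le_add (ofReal_two_mul_sqrt_le hd₁δ) hd₂δ
      set K := randomEncoder (phase f) (coeff σ) * coeff ψ with hK
      -- rounding the random encoder to `V` costs `2 √d₁`
      have h1 : traceNorm (outMat U (V * coeff ψ) * (outMat U (V * coeff ψ))ᴴ
          - outMat U K * (outMat U K)ᴴ) ≤ 2 * √d₁ := by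
        refine (traceNorm_mul_conjTranspose_sub_le _ _).trans ?_
        rw [← outMat_sub, ← outMat_add, hsNorm_outMat hiso, hsNorm_outMat hiso]
        refine le_trans ?_ (sqrt_mul_one_add_sqrt_le (by positivity) hd₁1
          (show 2 * x₁ ≤ 7 / 10 * d₁ by rw [hd₁]; linarith))
        exact mul_le_mul (Real.le_sqrt_of_sq_le hV₁) ((hsNorm_add_le _ _).trans (add_le_add
          ((sq_le_one_iff₀ (hsNorm_nonneg _)).1 hVΨ) (Real.le_sqrt_of_sq_le hV₂)))
          (hsNorm_nonneg _) (by positivity)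
      have h2 : traceNorm (outMat U K * (outMat U K)ᴴ - ωE ⊗ₖ ψR) ≤ 2 * x₂ := by
        rw [hK, ← twistSqrt_eq_outMat, twistSqrt_mul_conjTranspose]
        change traceNorm (_ - traceFst ωAE ⊗ₖ traceFst ψAR) ≤ _
        rw [eωAE, eψAR]
        exact hf₂
      refine (traceNorm_sub_le _ (outMat U K * (outMat U K)ᴴ) _).trans ?_
      rw [hd₂]
      linarith
  -- a decoupled environment allows the receiver to restore `ψ`
  obtain ⟨D, hD, hDη⟩ := exists_decoder (Y := outMat U (V * coeff ψ))
    (X := productPurification Ω (coeff ψ)) (η := η)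
    (by rwa [hsNorm_outMat hiso]) hX1.le (by rwa [hX])
  refine ⟨V, D, hV, hD, ?_, ?_⟩
  · rw [eψAR, applyFst_complementary]
    exact (ENNReal.ofReal_le_ofReal hdec).trans hηδ
  · rw [assoc_applyFst hU, ← marginal_productPurification Ω hΩ1 ψ]
    exact (ENNReal.ofReal_le_ofReal hDη).trans (ofReal_two_mul_sqrt_le hηδ)
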